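/- Call a number field $F$ totally non-Abelian if $F/\mathbb{Q}$ is Galois and $\mathrm{Gal}(F/\mathbb{Q})$ is a perfect group, i.e. equal to its own commutator subgroup (the trivial group counts as perfect). Fix an algebraically closed field $\Omega$ of characteristic $0$ (for example $\mathbb{C}$) and, for each integer $q\ge 1$, a primitive $q$-th root of unity $\zeta_q\in\Omega$. Let $F\subset\Omega$ be a number field that is Galois over $\mathbb{Q}$. Then the following are equivalent: (a) $F$ is totally non-Abelian; (b) $F$ is linearly disjoint over $\mathbb{Q}$ from the cyclotomic field $\mathbb{Q}(\zeta_q)$ for every $q\ge 1$; (c) $F\cap\mathbb{Q}(\zeta_q)=\mathbb{Q}$ for every $q\ge 1$. -/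

import Mathlib

open scoped IntermediateField

/-- A number field `F` is *totally non-Abelian* if `F/ℚ` is Galois and `Gal(F/ℚ)` is a perfect
group, i.e. equal to its own commutator subgroup (so the trivial group is perfect). -/
def IsTotallyNonAbelian (F : Type*) [Field F] [NumberField F] : Prop :=
  IsGalois ℚ F ∧ Group.IsPerfect (F ≃ₐ[ℚ] F)

/-!
Conditions (b) and (c) agree because `F` is Galois (`IntermediateField.LinearDisjoint.iff_inf_eq_bot`).
If `Gal(F/ℚ)` is perfect, then `F ⊓ ℚ(ζ_q)` is Galois over `ℚ` with a group that is both abelian and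
a quotient of a perfect group, so it is trivial (`inf_eq_bot_of_isPerfect`). If `Gal(F/ℚ)` is not
perfect, it has a normal subgroup of prime index `ℓ`, and `F` contains a cyclic extension `L` of `ℚ`
of degree `ℓ`. What remains is the Kronecker–Weber theorem in prime degree: such an `L` lies in a
cyclotomic field (`exists_le_adjoin_of_finrank_eq_prime`).

For this, put `N = ℓ ^ 3 ∏ p`, the product over the primes `p ≠ ℓ` dividing the discriminant of `L`,
and `M = L(ζ_N)`, an abelian extension of `ℚ`. By Minkowski's theorem `Gal(M/ℚ)` is generated by
inertia groups, one for each prime (`eq_top_of_inertia_le`), and those at the primes not dividing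
`N` are trivial. It is shown that the inertia groups at `p` and at `ℓ` have at most `p - 1` and
`φ(ℓ ^ 3)` elements. Then `[M : ℚ] ≤ φ(N) = [ℚ(ζ_N) : ℚ]`, hence `M = ℚ(ζ_N)` contains `L`
(`adjoin_eq_top_of_sup_adjoin_eq_top`).

At `p ≠ ℓ`, inertia has order prime to `p`, so the tame character embeds it into the multiplicative
group of the residue field. Since `Gal(M/ℚ)` is abelian, the values of the character are invariant
under Frobenius, so they lie in `𝔽_p`, and there are at most `p - 1` of them
(`card_inertia_le_sub_one`).

At `ℓ`, restriction to the `ℓ ^ 3`-th roots of unity is injective on inertia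
(`inertia_apply_eq_of_mem`). Let `ζ` be a primitive `ℓ`-th root of unity and `θ` a Lagrange resolvent
generating `L(ζ)` over `ℚ(ζ)`. As `L(ζ)` is abelian over `ℚ`, conjugating `α = θ ^ ℓ` by `ζ ↦ ζ ^ a`
gives `α ^ a` up to an `ℓ`-th power. For odd `ℓ` this forces `α ^ (ℓ - 1) ≡ 1` modulo `(ζ - 1) ^ ℓ`,
up to an `ℓ`-th power and a power of `ζ` (`exists_pow_mul_eq_one_add_of_eigenvector`); the latter is
an `ℓ`-th power once the `ℓ ^ 2`-th roots of unity are adjoined. For `ℓ = 2` the eighth roots of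
unity play this role (`exists_sq_mul_eq_one_add`). A Kummer generator whose `ℓ`-th power is `1`
modulo `(ζ - 1) ^ ℓ` is fixed by the inertia elements that fix `ζ`
(`inertia_apply_eq_of_pow_eq_one_add`).
-/

open NumberField

section NumberField

variable {M : Type*} [Field M] [NumberField M]

/-! ### Inertia groups and Minkowski's theorem -/

lemma inertia_smul_coe (σ : Gal(M/ℚ)) (x : 𝓞 M) : ((σ • x : 𝓞 M) : M) = σ (x : M) := rfl

/-- Minkowski's theorem in group-theoretic form: if a normal subgroup contains an inertia group above
every prime number, then its fixed field is unramified over `ℚ`, hence equal to `ℚ`. For an abelian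
Galois group this says that the inertia groups generate it. -/
lemma eq_top_of_inertia_le [IsGalois ℚ M] (H : Subgroup Gal(M/ℚ)) [H.Normal]
    (h : ∀ p : ℕ, p.Prime → ∃ P : Ideal (𝓞 M), P.IsPrime ∧ (p : 𝓞 M) ∈ P ∧
      P.inertia Gal(M/ℚ) ≤ H) : H = ⊤ := by
  let K : IntermediateField ℚ M := IntermediateField.fixedField H
  have : IsGalois ℚ K := IsGalois.of_fixedField_normal_subgroup H
  have hgal : IsGaloisGroup H K M := IsGaloisGroup.subgroup Gal(M/ℚ) ℚ M H
  have : IsGaloisGroup H (𝓞 K) (𝓞 M) := IsGaloisGroup.of_isFractionRing H (𝓞 K) (𝓞 M) K M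
  suffices hK : K = ⊥ by
    rw [← IntermediateField.fixingSubgroup_fixedField H]
    change K.fixingSubgroup = ⊤
    rw [hK, IntermediateField.fixingSubgroup_bot]
  by_contra hK
  have h1 : 1 < Module.finrank ℚ K := by
    have h0 : 0 < Module.finrank ℚ K := Module.finrank_pos
    have : Module.finrank ℚ K ≠ 1 := fun h ↦ hK (IntermediateField.finrank_eq_one_iff.mp h)
    omega
  obtain ⟨p, hp, hram⟩ := exists_not_isUnramifiedAt_int_of_isGalois (𝒪 := 𝓞 K) h1
  obtain ⟨P, hP, hpP, hle⟩ := h p hp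
  let Q : Ideal (𝓞 K) := P.under (𝓞 K)
  have hQ : Q.IsPrime := inferInstance
  have : P.LiesOver Q := ⟨rfl⟩
  have : Q.LiesOver (P.under ℤ) := ⟨by rw [Ideal.under_under]⟩
  have hpZ : (p : ℤ) ∈ P.under ℤ := by simpa using hpP
  have hpQ : (p : 𝓞 K) ∈ Q := by simpa [Q] using hpP
  refine hram Q hQ hpQ ?_
  have hfin : Finite (ℤ ⧸ P.under ℤ) :=
    Ring.HasFiniteQuotients.finiteQuotient (fun h0 ↦ by
      rw [h0] at hpZ; exact hp.ne_zero (by simpa using hpZ))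
  have hfin' : Finite (𝓞 K ⧸ Q) :=
    Ring.HasFiniteQuotients.finiteQuotient (fun h0 ↦ by
      rw [h0] at hpQ; exact hp.ne_zero (by simpa using hpQ))
  have hZmax : (P.under ℤ).IsMaximal :=
    Ideal.Quotient.maximal_of_isField _ (Finite.isField_of_domain _)
  have hQmax : Q.IsMaximal :=
    Ideal.Quotient.maximal_of_isField _ (Finite.isField_of_domain _)
  -- the two inertia groups have the same order, so `e(P/p) = e(P/Q)` and therefore `e(Q/p) = 1`
  have e1 := Ideal.card_inertia_eq_ramificationIdxIn (G := Gal(M/ℚ)) (P.under ℤ) P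
  have e2 := Ideal.card_inertia_eq_ramificationIdxIn (G := H) Q P
  rw [Ideal.ramificationIdxIn_eq_ramificationIdx _ P Gal(M/ℚ)] at e1
  rw [Ideal.ramificationIdxIn_eq_ramificationIdx _ P H] at e2
  have e3 : Nat.card (P.inertia Gal(M/ℚ)) = Nat.card (P.inertia H) := by
    refine (Nat.card_congr (Subgroup.subgroupOfEquivOfLe hle).toEquiv).symm.trans ?_
    rw [AddSubgroup.subgroupOf_inertia]
  have e4 := Ideal.ramificationIdx_tower (R := ℤ) Q P
  have e5 : 0 < P.ramificationIdx (𝓞 K) := Ideal.ramificationIdx_pos P (𝓞 K)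
  rw [← e1, e3, e2] at e4
  rw [← Ideal.ramificationIdx_eq_one_iff]
  exact (Nat.eq_of_mul_eq_mul_right e5 (by rw [one_mul]; exact e4)).symm

/-- An inertia element at `P` fixes the roots of unity of order prime to `P`: the quotient
`u = σz / z` is congruent to `1`, and if `u ≠ 1` then `m ≡ 1 + u + ⋯ + u ^ (m - 1) = 0`. -/
lemma inertia_smul_eq_of_pow_eq_one {P : Ideal (𝓞 M)} {σ : Gal(M/ℚ)}
    (hσ : σ ∈ P.inertia Gal(M/ℚ)) {m : ℕ} (hm : (m : 𝓞 M) ∉ P) {z : 𝓞 M} (hz : z ^ m = 1) :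
    σ • z = z := by
  have hm0 : m ≠ 0 := by rintro rfl; simp at hm
  obtain ⟨k, rfl⟩ := Nat.exists_eq_succ_of_ne_zero hm0
  rw [Nat.succ_eq_add_one] at *
  set u := σ • z * z ^ k with hu
  have huz : u * z = σ • z := by rw [hu, mul_assoc, ← pow_succ, hz, mul_one]
  have hum : u ^ (k + 1) = 1 := by
    rw [hu, mul_pow, ← smul_pow', hz, ← pow_mul, mul_comm k, pow_mul, hz]; simp
  have hu1 : u - 1 ∈ P := by
    have : u - 1 = (σ • z - z) * z ^ k := by rw [sub_mul, ← hu, ← pow_succ', hz]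
    rw [this]
    exact P.mul_mem_right _ (hσ z)
  by_cases h1 : u = 1
  · rw [← huz, h1, one_mul]
  exfalso
  apply hm
  have h0 : ∑ i ∈ Finset.range (k + 1), u ^ i = 0 := by
    have := geom_sum_mul u (k + 1)
    rw [hum, sub_self, mul_eq_zero, sub_eq_zero] at this
    exact this.resolve_right h1
  have h2 : ∑ i ∈ Finset.range (k + 1), (u ^ i - 1) ∈ P :=
    sum_mem fun i _ ↦ P.mem_of_dvd (sub_one_dvd_pow_sub_one u i) hu1
  rw [Finset.sum_sub_distrib, h0, zero_sub] at h2
  simpa using neg_mem h2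

lemma natCast_mem_iff_dvd {p : ℕ} (hp : p.Prime) {P : Ideal (𝓞 M)} [P.IsPrime]
    (hpP : (p : 𝓞 M) ∈ P) {n : ℕ} : (n : 𝓞 M) ∈ P ↔ p ∣ n := by
  refine ⟨fun h ↦ ?_, fun ⟨k, hk⟩ ↦ by rw [hk, Nat.cast_mul]; exact P.mul_mem_right _ hpP⟩
  by_contra hnd
  obtain ⟨a, b, hab⟩ : IsCoprime (p : ℤ) (n : ℤ) :=
    Nat.isCoprime_iff_coprime.mpr ((Nat.Prime.coprime_iff_not_dvd hp).mpr hnd)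
  apply (Ideal.ne_top_iff_one P).mp Ideal.IsPrime.ne_top'
  have : (1 : 𝓞 M) = a * p + b * n := by exact_mod_cast congrArg (Int.cast : ℤ → 𝓞 M) hab.symm
  rw [this]
  exact add_mem (P.mul_mem_left _ hpP) (P.mul_mem_left _ h)

/-! ### The tame character -/

lemma gal_eq_one_of_forall_smul_eq {σ : Gal(M/ℚ)} (h : ∀ x : 𝓞 M, σ • x = x) : σ = 1 := by
  ext x
  obtain ⟨a, b, -, rfl⟩ := IsFractionRing.div_surjective (𝓞 M) x
  have h' (y : 𝓞 M) : σ (algebraMap (𝓞 M) M y) = algebraMap (𝓞 M) M y :=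
    (inertia_smul_coe σ y).symm.trans (congrArg _ (h y))
  simp [map_div₀, h']

lemma smul_mem_pow_of_forall_smul_mem {P : Ideal (𝓞 M)} {σ : Gal(M/ℚ)}
    (hσ : ∀ x ∈ P, σ • x ∈ P) (n : ℕ) {x : 𝓞 M} (hx : x ∈ P ^ n) : σ • x ∈ P ^ n := by
  have h1 : P.map (MulSemiringAction.toRingHom Gal(M/ℚ) (𝓞 M) σ) ≤ P :=
    Ideal.map_le_iff_le_comap.mpr hσ
  have h2 := Ideal.mem_map_of_mem (MulSemiringAction.toRingHom Gal(M/ℚ) (𝓞 M) σ) hx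
  rw [Ideal.map_pow] at h2
  exact Ideal.pow_right_mono h1 n h2

lemma smul_mem_of_mem_inertia {P : Ideal (𝓞 M)} {σ : Gal(M/ℚ)}
    (hσ : σ ∈ P.inertia Gal(M/ℚ)) {x : 𝓞 M} (hx : x ∈ P) : σ • x ∈ P := by
  simpa using P.add_mem (hσ x) hx

/-- An inertia element that acts trivially on `P / P ^ 2` acts trivially on every
`P ^ i / P ^ (i + 1)`. -/
lemma smul_sub_mem_pow_succ {P : Ideal (𝓞 M)} {σ : Gal(M/ℚ)}
    (hσ : σ ∈ P.inertia Gal(M/ℚ)) (hσ2 : ∀ x ∈ P, σ • x - x ∈ P ^ 2) (i : ℕ) :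
    ∀ x ∈ P ^ i, σ • x - x ∈ P ^ (i + 1) := by
  induction i with
  | zero => intro x _; simpa using hσ x
  | succ i ih =>
    intro x hx
    rw [pow_succ] at hx
    refine Submodule.mul_induction_on hx (fun a ha b hb ↦ ?_) (fun a b ha hb ↦ ?_)
    · have h1 : σ • (a * b) - a * b = (σ • a - a) * σ • b + a * (σ • b - b) := by
        rw [smul_mul']; ring
      rw [h1]
      refine add_mem ?_ ?_
      · rw [pow_succ]
        exact Ideal.mul_mem_mul (ih a ha) (smul_mem_of_mem_inertia hσ hb)
      · rw [add_assoc, pow_add]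
        exact Ideal.mul_mem_mul ha (hσ2 b hb)
    · have : σ • (a + b) - (a + b) = (σ • a - a) + (σ • b - b) := by rw [smul_add]; ring
      rw [this]
      exact add_mem ha hb

/-- The kernel of the tame character contains no element of order prime to the residue
characteristic. If `σ` is trivial modulo `P ^ i`, then `x ↦ σx - x` is additive along powers of
`σ` modulo `P ^ (i + 1)`, so `σ ^ n = 1` gives `n (σx - x) ∈ P ^ (i + 1)`. -/
lemma eq_one_of_smul_sub_mem_sq {P : Ideal (𝓞 M)} [P.IsPrime] {σ : Gal(M/ℚ)}
    (hσ : σ ∈ P.inertia Gal(M/ℚ)) (hσ2 : ∀ x ∈ P, σ • x - x ∈ P ^ 2) {n : ℕ}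
    (hn : (n : 𝓞 M) ∉ P) (hσn : σ ^ n = 1) : σ = 1 := by
  have key : ∀ i : ℕ, ∀ x : 𝓞 M, σ • x - x ∈ P ^ i := by
    intro i
    induction i with
    | zero => intro x; simp
    | succ i ih =>
      intro x
      have h1 : ∀ k : ℕ, σ ^ k • x - x - k * (σ • x - x) ∈ P ^ (i + 1) := by
        intro k
        induction k with
        | zero => simp
        | succ k ihk =>
          have h2 := smul_sub_mem_pow_succ hσ hσ2 i _ (ih x)
          have h3 := smul_mem_pow_of_forall_smul_mem
            (fun x hx ↦ smul_mem_of_mem_inertia hσ hx) (i + 1) ihk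
          have h4 : σ ^ (k + 1) • x - x - ((k + 1 : ℕ) : 𝓞 M) * (σ • x - x) =
              σ • (σ ^ k • x - x - k * (σ • x - x)) + k * (σ • (σ • x - x) - (σ • x - x)) := by
            have : σ • (k : 𝓞 M) = k := map_natCast (MulSemiringAction.toRingHom _ (𝓞 M) σ) k
            rw [pow_succ', mul_smul]
            simp only [smul_sub, smul_mul', this]
            push_cast
            ring
          rw [h4]
          exact add_mem h3 (Ideal.mul_mem_left _ _ h2)
      have h5 := h1 n
      rw [hσn, one_smul, sub_self, zero_sub] at h5
      have h6 := neg_mem h5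
      rw [neg_neg] at h6
      exact (Ideal.IsPrime.mul_mem_pow P h6).resolve_left hn
  apply gal_eq_one_of_forall_smul_eq
  intro x
  have h : σ • x - x ∈ ⨅ i, P ^ i := by
    rw [Submodule.mem_iInf]
    exact fun i ↦ key i x
  rw [Ideal.iInf_pow_eq_bot_of_isDomain P (Ideal.IsPrime.ne_top ‹_›)] at h
  exact sub_eq_zero.mp h

/-- In an abelian extension of `ℚ` the tame character of an inertia group takes values in the prime
field: it is compatible with conjugation by a Frobenius element, hence fixed by Frobenius.
So an inertia group at `p` of order prime to `p` has at most `p - 1` elements. -/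
theorem card_inertia_le_sub_one [IsGalois ℚ M] (hcomm : ∀ σ τ : Gal(M/ℚ), σ * τ = τ * σ)
    {p : ℕ} (hp : p.Prime) {P : Ideal (𝓞 M)} [P.IsPrime] (hpP : (p : 𝓞 M) ∈ P) {n : ℕ}
    (hn : (n : 𝓞 M) ∉ P) (hσn : ∀ σ ∈ P.inertia Gal(M/ℚ), σ ^ n = 1) :
    Nat.card (P.inertia Gal(M/ℚ)) ≤ p - 1 := by
  have hP0 : P ≠ ⊥ := fun h ↦ hp.ne_zero (by rw [h] at hpP; simpa using hpP)
  have hfin : Finite (𝓞 M ⧸ P) := Ring.HasFiniteQuotients.finiteQuotient hP0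
  obtain ⟨π, hπ, hπ2⟩ : ∃ π ∈ P, π ∉ P ^ 2 := by
    have := Ideal.pow_succ_lt_pow hP0 1
    rw [pow_one] at this
    exact SetLike.exists_of_lt this
  have hrep (x : 𝓞 M) (hx : x ∈ P) : ∃ d, ∃ e ∈ P ^ 2, π * d + e = x :=
    Ideal.exists_mul_add_mem_pow_succ hP0 (i := 1) π x (by simpa using hπ) hπ2 (by simpa using hx)
  -- the prime below `P` is `(p)`, so that a Frobenius at `P` is `x ↦ x ^ p`
  have hcard : Nat.card (ℤ ⧸ P.under ℤ) = p := by
    have h1 : P.under ℤ = Ideal.span {(p : ℤ)} :=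
      ((Ideal.liesOver_span_iff Ideal.IsPrime.ne_top' (Nat.prime_iff_prime_int.mp hp)).mpr
        (by simpa using hpP)).1.symm
    rw [h1, ← Submodule.cardQuot_apply, ← Ideal.absNorm_apply, Ideal.absNorm_span_singleton]
    simp
  obtain ⟨φ, hφ⟩ := IsArithFrobAt.exists_of_isInvariant ℤ Gal(M/ℚ) P
  have hφ' (x : 𝓞 M) : φ • x - x ^ p ∈ P := by
    have := hφ x
    rwa [hcard] at this
  have hφP (x : 𝓞 M) : φ • x ∈ P ↔ x ∈ P := by
    constructor
    · intro h
      have := P.sub_mem h (hφ' x)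
      rw [sub_sub_cancel] at this
      exact Ideal.IsPrime.mem_of_pow_mem ‹_› _ this
    · intro h
      have := P.add_mem (hφ' x) (P.pow_mem_of_mem h p hp.pos)
      rwa [sub_add_cancel] at this
  have hφinv (x : 𝓞 M) (hx : x ∈ P) : φ⁻¹ • x ∈ P := by
    rw [← hφP, smul_inv_smul]; exact hx
  have hφπ : φ • π ∈ P := (hφP π).mpr hπ
  have hφπ2 : φ • π ∉ P ^ 2 := fun h ↦ hπ2 (by
    have := smul_mem_pow_of_forall_smul_mem hφinv 2 h
    rwa [inv_smul_smul] at this)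
  have hchar (σ : P.inertia Gal(M/ℚ)) : ∃ a : 𝓞 M, σ.1 • π - π * a ∈ P ^ 2 := by
    obtain ⟨d, e, he, h⟩ := hrep (σ.1 • π) (smul_mem_of_mem_inertia σ.2 hπ)
    exact ⟨d, by rw [← h]; simpa using he⟩
  -- the tame character `χ`, lifted to `𝓞 M`: `σπ ≡ π χ(σ)` modulo `P ^ 2`
  choose χ hχ using hchar
  have hχP (σ : P.inertia Gal(M/ℚ)) : χ σ ∉ P := by
    intro h
    have h1 : σ.1 • π ∈ P ^ 2 := by
      have := add_mem (hχ σ) (show π * χ σ ∈ P ^ 2 by rw [pow_two]; exact Ideal.mul_mem_mul hπ h)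
      rwa [sub_add_cancel] at this
    have := smul_mem_pow_of_forall_smul_mem
      (fun x hx ↦ smul_mem_of_mem_inertia (inv_mem σ.2) hx) 2 h1
    rw [inv_smul_smul] at this
    exact hπ2 this
  have hfrob (σ : P.inertia Gal(M/ℚ)) : χ σ ^ p - χ σ ∈ P := by
    obtain ⟨d, e, he, hd⟩ := hrep (φ • π) hφπ
    have h1 : σ.1 • φ • π = φ • σ.1 • π := by rw [← mul_smul, ← mul_smul, hcomm]
    -- apply `φ` to the relation `σπ ≡ π a`
    have h2 : φ • σ.1 • π - φ • π * φ • χ σ ∈ P ^ 2 := by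
      have := smul_mem_pow_of_forall_smul_mem (fun x hx ↦ (hφP x).mpr hx) 2 (hχ σ)
      rwa [smul_sub, smul_mul'] at this
    -- the uniformizer `φπ` has the same tame character as `π`
    have h3 : σ.1 • φ • π - φ • π * χ σ ∈ P ^ 2 := by
      have e1 : σ.1 • φ • π - φ • π * χ σ = (σ.1 • π - π * χ σ) * σ.1 • d +
          χ σ * (π * (σ.1 • d - d)) + (σ.1 • e - e * χ σ) := by
        rw [← hd, smul_add, smul_mul']; ring
      rw [e1]
      refine add_mem (add_mem (Ideal.mul_mem_right _ _ (hχ σ)) (Ideal.mul_mem_left _ _ ?_))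
        (sub_mem ?_ (Ideal.mul_mem_right _ _ he))
      · rw [pow_two]; exact Ideal.mul_mem_mul hπ (σ.2 d)
      · exact smul_mem_pow_of_forall_smul_mem (fun x hx ↦ smul_mem_of_mem_inertia σ.2 hx) 2 he
    have h4 : φ • π * (φ • χ σ - χ σ) ∈ P ^ 2 := by
      have := sub_mem h3 h2
      rw [h1] at this
      convert this using 1
      ring
    have h5 : φ • χ σ - χ σ ∈ P := Ideal.mem_prime_of_mul_mem_pow hP0 (i := 1) hφπ2 h4
    have := P.sub_mem h5 (hφ' (χ σ))
    convert this using 1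
    ring
  have hfield : IsField (𝓞 M ⧸ P) := Finite.isField_of_domain _
  let _ : Field (𝓞 M ⧸ P) := hfield.toField
  let f : P.inertia Gal(M/ℚ) → Polynomial.nthRootsFinset (p - 1) (1 : 𝓞 M ⧸ P) := fun σ ↦
    ⟨Ideal.Quotient.mk P (χ σ), by
      rw [Polynomial.mem_nthRootsFinset (Nat.sub_pos_of_lt hp.one_lt)]
      have h0 : Ideal.Quotient.mk P (χ σ) ≠ 0 := by
        rw [Ne, Ideal.Quotient.eq_zero_iff_mem]; exact hχP σ
      have h1 : Ideal.Quotient.mk P (χ σ) ^ p = Ideal.Quotient.mk P (χ σ) := by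
        rw [← map_pow, Ideal.Quotient.eq]; exact hfrob σ
      apply mul_right_cancel₀ h0
      rw [← pow_succ, Nat.sub_add_cancel hp.one_le, h1, one_mul]⟩
  have hf : Function.Injective f := by
    intro σ τ h
    have h1 : χ σ - χ τ ∈ P := Ideal.Quotient.eq.mp (congrArg Subtype.val h)
    have h2 : σ.1 • π - τ.1 • π ∈ P ^ 2 := by
      have : σ.1 • π - τ.1 • π = (σ.1 • π - π * χ σ) - (τ.1 • π - π * χ τ) +
        π * (χ σ - χ τ) := by ring
      rw [this]
      refine add_mem (sub_mem (hχ σ) (hχ τ)) ?_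
      rw [pow_two]; exact Ideal.mul_mem_mul hπ h1
    have h3 : (τ⁻¹ * σ).1 • π - π ∈ P ^ 2 := by
      have := smul_mem_pow_of_forall_smul_mem
        (fun x hx ↦ smul_mem_of_mem_inertia (inv_mem τ.2) hx) 2 h2
      rw [smul_sub, inv_smul_smul, ← mul_smul] at this
      exact this
    have h4 : (τ⁻¹ * σ).1 = 1 := by
      refine eq_one_of_smul_sub_mem_sq (τ⁻¹ * σ).2 (fun x hx ↦ ?_) hn (hσn _ (τ⁻¹ * σ).2)
      obtain ⟨d, e, he, rfl⟩ := hrep x hx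
      set ρ := (τ⁻¹ * σ) with hρ
      have e1 : ρ.1 • (π * d + e) - (π * d + e) = (ρ.1 • π - π) * ρ.1 • d +
          π * (ρ.1 • d - d) + (ρ.1 • e - e) := by
        rw [smul_add, smul_mul']; ring
      rw [e1]
      refine add_mem (add_mem (Ideal.mul_mem_right _ _ h3) ?_) (sub_mem ?_ he)
      · rw [pow_two]; exact Ideal.mul_mem_mul hπ (ρ.2 d)
      · exact smul_mem_pow_of_forall_smul_mem (fun x hx ↦ smul_mem_of_mem_inertia ρ.2 hx) 2 he
    have h5 : τ⁻¹ * σ = 1 := Subtype.ext h4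
    exact (inv_mul_eq_one.mp h5).symm
  calc Nat.card (P.inertia Gal(M/ℚ))
      ≤ Nat.card (Polynomial.nthRootsFinset (p - 1) (1 : 𝓞 M ⧸ P)) :=
        Nat.card_le_card_of_injective f hf
    _ = (Polynomial.nthRootsFinset (p - 1) (1 : 𝓞 M ⧸ P)).card := by
        rw [Nat.card_eq_fintype_card, Fintype.card_coe]
    _ ≤ p - 1 := by
        classical
        rw [Polynomial.nthRootsFinset_def]
        exact (Multiset.toFinset_card_le _).trans (Polynomial.card_nthRoots _ _)

/-! ### Kummer generators fixed by inertia -/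

/-- If `η ^ ℓ ≡ 1` modulo `(ζ - 1) ^ ℓ`, then `η` generates an extension unramified at `ℓ`.
Indeed `y = (η - 1) / (ζ - 1)` is integral, and an automorphism `η ↦ ζ ^ j η` moves `y` by
`(1 + ζ + ⋯ + ζ ^ (j - 1)) η ≡ j`, which is nonzero modulo `P` unless `ℓ ∣ j`. -/
theorem inertia_apply_eq_of_pow_eq_one_add {ℓ : ℕ} (hℓ : ℓ.Prime) {ζ : M}
    (hζ : IsPrimitiveRoot ζ ℓ) {P : Ideal (𝓞 M)} [P.IsPrime] (hℓP : (ℓ : 𝓞 M) ∈ P)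
    {τ : Gal(M/ℚ)} (hτ : τ ∈ P.inertia Gal(M/ℚ)) (hτζ : τ ζ = ζ) {η : M}
    (hτη : τ η ^ ℓ = η ^ ℓ) {x : 𝓞 M} (h : η ^ ℓ = 1 + x * (ζ - 1) ^ ℓ) : τ η = η := by
  have : Fact ℓ.Prime := ⟨hℓ⟩
  have : NeZero ℓ := ⟨hℓ.ne_zero⟩
  set Z : 𝓞 M := hζ.toInteger with hZ
  have hZc : (Z : M) = ζ := rfl
  have hη : IsIntegral ℤ η := by
    have : IsIntegral ℤ (η ^ ℓ) := by
      have e : η ^ ℓ = ((1 + x * (Z - 1) ^ ℓ : 𝓞 M) : M) := by rw [h]; simp [hZc]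
      rw [e]
      exact RingOfIntegers.isIntegral_coe _
    exact this.of_pow hℓ.pos
  obtain ⟨H, rfl⟩ : ∃ H : 𝓞 M, (H : M) = η := ⟨⟨η, hη⟩, rfl⟩
  have hH : H ^ ℓ = 1 + x * (Z - 1) ^ ℓ := by
    apply RingOfIntegers.ext
    simpa [hZc] using h
  obtain ⟨u, hu⟩ := IsCyclotomicExtension.Rat.associated_zeta_sub_one_pow_prime ℓ hζ
  rw [← hZ] at hu
  have hl0 : ζ - 1 ≠ 0 := sub_ne_zero.mpr (hζ.ne_one hℓ.one_lt)
  have hlP : Z - 1 ∈ P := by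
    refine Ideal.IsPrime.mem_of_pow_mem ‹_› (ℓ - 1) ?_
    rw [← hu] at hℓP
    exact (Ideal.mul_unit_mem_iff_mem P u.isUnit).mp hℓP
  obtain ⟨r, hr⟩ := exists_add_pow_prime_eq hℓ (H - 1) 1
  rw [sub_add_cancel, hH, ← hu] at hr
  -- dividing `((η - 1) + 1) ^ ℓ = 1 + x (ζ - 1) ^ ℓ` by `(ζ - 1) ^ ℓ ~ ℓ (ζ - 1)` gives a monic
  -- integral equation for `(η - 1) / (ζ - 1)`
  obtain ⟨Y, hY⟩ : ∃ Y : 𝓞 M, H - 1 = (Z - 1) * Y := by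
    have hint : IsIntegral (𝓞 M) (((H : M) - 1) / (ζ - 1)) := by
      refine ⟨Polynomial.X ^ ℓ + (Polynomial.C (u * r) * Polynomial.X + Polynomial.C (-x)),
        Polynomial.monic_X_pow_add ?_, ?_⟩
      · exact Polynomial.degree_linear_le.trans_lt (by exact_mod_cast hℓ.one_lt)
      · have hr' := congrArg (fun z : 𝓞 M ↦ (z : M)) hr
        simp only [map_add, map_mul, map_pow, map_sub, map_one, hZc, one_pow] at hr'
        simp only [Polynomial.eval₂_add, Polynomial.eval₂_mul, Polynomial.eval₂_neg,
          Polynomial.eval₂_pow, Polynomial.eval₂_X, Polynomial.eval₂_C, map_mul, map_neg]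
        have hpow : (ζ - 1) ^ ℓ = (ζ - 1) ^ (ℓ - 1) * (ζ - 1) := by
          rw [← pow_succ, Nat.sub_add_cancel hℓ.one_le]
        rw [div_pow]
        field_simp
        rw [hpow] at hr' ⊢
        linear_combination -(ζ - 1) * hr'
    obtain ⟨Y, hY⟩ := IsIntegrallyClosed.isIntegral_iff.mp hint
    refine ⟨Y, RingOfIntegers.ext ?_⟩
    have : (Y : M) = ((H : M) - 1) / (ζ - 1) := hY
    simp only [map_mul, map_sub, map_one, hZc, this]
    field_simp
  have hZτ : τ • Z = Z := RingOfIntegers.ext hτζ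
  have hHP : H ∉ P := by
    intro hmem
    have h1 := P.pow_mem_of_mem hmem ℓ hℓ.pos
    rw [hH] at h1
    have h2 := P.sub_mem h1 (P.mul_mem_left x (P.pow_mem_of_mem hlP ℓ hℓ.pos))
    rw [add_sub_cancel_right] at h2
    exact (Ideal.ne_top_iff_one P).mp Ideal.IsPrime.ne_top' h2
  -- `τ` multiplies `η` by a power of `ζ`
  obtain ⟨j, hj⟩ : ∃ j : ℕ, τ • H = Z ^ j * H := by
    have hH0 : (H : M) ≠ 0 := fun h0 ↦ hHP (by
      have : H = 0 := RingOfIntegers.ext h0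
      rw [this]; exact P.zero_mem)
    have h1 : (τ (H : M) / H) ^ ℓ = 1 := by
      rw [div_pow, hτη, div_self (pow_ne_zero _ hH0)]
    obtain ⟨j, -, hj⟩ := hζ.eq_pow_of_pow_eq_one h1
    refine ⟨j, RingOfIntegers.ext ?_⟩
    change τ (H : M) = ζ ^ j * H
    rw [hj, div_mul_cancel₀ _ hH0]
  have h1 : (Z - 1) * (τ • Y - Y) = (Z - 1) * ((∑ i ∈ Finset.range j, Z ^ i) * H) := by
    have h2 : (Z - 1) * τ • Y = τ • H - 1 := by
      have : τ • ((Z - 1) * Y) = (Z - 1) * τ • Y := by rw [smul_mul', smul_sub, hZτ, smul_one]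
      rw [← this, ← hY, smul_sub, smul_one]
    rw [mul_sub, h2, ← hY, hj, ← mul_assoc, mul_comm (Z - 1) (Finset.sum _ _), geom_sum_mul]
    ring
  have hl0' : Z - 1 ≠ 0 := fun h0 ↦ hl0 (by
    have := congrArg (fun z : 𝓞 M ↦ (z : M)) h0
    simpa [hZc] using this)
  have h2 : (∑ i ∈ Finset.range j, Z ^ i) * H ∈ P := by
    rw [← mul_left_cancel₀ hl0' h1]; exact hτ Y
  have h3 : (j : 𝓞 M) ∈ P := by
    have h4 := (Ideal.IsPrime.mem_or_mem ‹_› h2).resolve_right hHP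
    have h5 : ∑ i ∈ Finset.range j, (Z ^ i - 1) ∈ P :=
      sum_mem fun i _ ↦ P.mem_of_dvd (sub_one_dvd_pow_sub_one Z i) hlP
    rw [Finset.sum_sub_distrib] at h5
    have := P.sub_mem h4 h5
    simpa using this
  obtain ⟨k, rfl⟩ := (natCast_mem_iff_dvd hℓ hℓP).mp h3
  rw [← inertia_smul_coe, hj, pow_mul]
  have : Z ^ ℓ = 1 := hζ.toInteger_isPrimitiveRoot.pow_eq_one
  rw [this, one_pow, one_mul]

/-! ### A congruence for eigenvectors in the cyclotomic ring -/

lemma exists_one_add_pow_eq {R : Type*} [CommRing R] (t : R) (a : ℕ) :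
    ∃ g : R, (1 + t) ^ a = 1 + t * g ∧ t ∣ g - a := by
  refine ⟨∑ i ∈ Finset.range a, (1 + t) ^ i, ?_, ?_⟩
  · have := mul_geom_sum (1 + t) a
    rw [add_sub_cancel_left] at this
    rw [this]; ring
  · have : ∑ i ∈ Finset.range a, (1 + t) ^ i - (a : R) =
        ∑ i ∈ Finset.range a, ((1 + t) ^ i - 1) := by
      rw [Finset.sum_sub_distrib]; simp
    rw [this]
    refine Finset.dvd_sum fun i _ ↦ ?_
    simpa using sub_one_dvd_pow_sub_one (1 + t) i

lemma Prime.eq_and_eq_of_pow_mul_eq_pow_mul {R : Type*} [CommRing R] [IsDomain R] {q : R}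
    (hq : Prime q) {m n : ℕ} {x y : R} (hx : ¬ q ∣ x) (hy : ¬ q ∣ y)
    (h : q ^ m * x = q ^ n * y) : m = n ∧ x = y := by
  have hmn : m = n := by
    rcases lt_trichotomy m n with hlt | heq | hlt
    · exfalso
      obtain ⟨d, rfl⟩ := Nat.exists_eq_add_of_lt hlt
      rw [add_assoc, pow_add, mul_assoc] at h
      have := mul_left_cancel₀ (pow_ne_zero _ hq.ne_zero) h
      exact hx ⟨q ^ d * y, by rw [this]; ring⟩
    · exact heq
    · exfalso
      obtain ⟨d, rfl⟩ := Nat.exists_eq_add_of_lt hlt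
      rw [add_assoc, pow_add, mul_assoc] at h
      have := mul_left_cancel₀ (pow_ne_zero _ hq.ne_zero) h
      exact hy ⟨q ^ d * x, by rw [← this]; ring⟩
  subst hmn
  exact ⟨rfl, mul_left_cancel₀ (pow_ne_zero _ hq.ne_zero) h⟩

/-- The congruence behind the wild case. Let `1 + l` behave like a primitive `p`-th root of unity
(`p` odd): `l` is prime with residue field `𝔽_p`, `l ^ (p - 1) ~ p`, and `s` is an endomorphism
with `s (1 + l) = (1 + l) ^ a` for a primitive root `a` modulo `p`. If `s α = α ^ a` up to a `p`-th
power, then up to a power of `1 + l` and a `p`-th power, `α ^ (p - 1) ≡ 1` modulo `l ^ p`. -/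
theorem exists_pow_mul_eq_one_add_of_eigenvector {R : Type*} [CommRing R] [IsDomain R]
    [IsNoetherianRing R] {l : R} (hl : Prime l) {p : ℕ} (hp : p.Prime) (hp2 : p ≠ 2)
    (hassoc : Associated (l ^ (p - 1)) (p : R)) (hres : ∀ x : R, ∃ n : ℤ, l ∣ x - n)
    (s : R →+* R) {a : ℕ} (ha : orderOf (a : ZMod p) = p - 1)
    (hs : s (1 + l) = (1 + l) ^ a) {α u v : R} (hα : α ≠ 0) (hu : u ≠ 0) (hv : v ≠ 0)
    (h : v ^ p * s α = α ^ a * u ^ p) :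
    ∃ b k : ℕ, ∃ x : R, α ^ (p - 1) * (1 + l) ^ b = l ^ (p * k) * (1 + x * l ^ p) := by
  have : Fact p.Prime := ⟨hp⟩
  have hp3 : 3 ≤ p := by have := hp.two_le; omega
  have hlp : l ∣ (p : R) := (dvd_pow_self l (by omega)).trans hassoc.dvd
  have hint (n : ℤ) : l ∣ (n : R) ↔ (p : ℤ) ∣ n := by
    constructor
    · intro hn
      by_contra hnd
      obtain ⟨c, d, hcd⟩ := (Prime.coprime_iff_not_dvd (Nat.prime_iff_prime_int.mp hp)).mpr hnd
      apply hl.not_isUnit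
      rw [isUnit_iff_dvd_one]
      have : (1 : R) = c * (p : R) + d * n := by
        exact_mod_cast congrArg (Int.cast : ℤ → R) hcd.symm
      rw [this]
      exact dvd_add (hlp.mul_left _) (hn.mul_left _)
    · rintro ⟨k, rfl⟩
      push_cast
      exact hlp.mul_right _
  have haz : (a : ZMod p) ≠ 0 := by
    intro h0
    rw [h0, orderOf_eq_zero_iff'.mpr] at ha
    · omega
    · intro n hn
      rw [zero_pow hn.ne']
      exact zero_ne_one
  have ha1 : (a : ZMod p) ≠ 1 := by
    intro h1
    rw [h1, orderOf_one] at ha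
    omega
  -- `s` acts on `l` by multiplication with `w ≡ a`, and trivially modulo `l`
  obtain ⟨w, hw, hwa⟩ := exists_one_add_pow_eq l a
  have hsl : s l = l * w := by
    rw [map_add, map_one, hw] at hs
    exact add_left_cancel hs
  have hsx (x : R) : l ∣ s x - x := by
    obtain ⟨n, y, hy⟩ := hres x
    have : s x - x = l * (w * s y - y) := by
      have hx : x = n + l * y := by rw [← hy]; ring
      rw [hx, map_add, map_mul, hsl, map_intCast]; ring
    exact ⟨_, this⟩
  have hndvd {x : R} (hx : ¬ l ∣ x) : ¬ l ∣ s x := fun hd ↦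
    hx ((dvd_sub_right hd).mp (hsx x))
  have hw0 : ¬ l ∣ w := by
    intro hd
    have := (dvd_sub_right hd).mp hwa
    rw [show (a : R) = ((a : ℤ) : R) by simp, hint] at this
    apply haz
    rw [show (a : ZMod p) = ((a : ℤ) : ZMod p) by simp]
    exact (ZMod.intCast_zmod_eq_zero_iff_dvd _ _).mpr this
  have hfermat {x : R} (hx : ¬ l ∣ x) : l ∣ x ^ (p - 1) - 1 := by
    obtain ⟨n, hn⟩ := hres x
    have hn0 : ¬ (p : ℤ) ∣ n := fun hd ↦ hx ((dvd_sub_left ((hint n).mpr hd)).mp hn)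
    have h1 : (p : ℤ) ∣ n ^ (p - 1) - 1 :=
      (Int.ModEq.pow_card_sub_one_eq_one hp
        ((Prime.coprime_iff_not_dvd (Nat.prime_iff_prime_int.mp hp)).mpr hn0).symm).symm.dvd
    have h2 := (hint _).mpr h1
    push_cast at h2
    have h3 := (hn.trans (sub_dvd_pow_sub_pow x (n : R) (p - 1))).add h2
    simpa using h3
  have hpow {x : R} (hx : l ∣ x - 1) : l ^ p ∣ x ^ p - 1 := by
    obtain ⟨r, hr⟩ := exists_add_pow_prime_eq hp (x - 1) 1
    rw [sub_add_cancel] at hr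
    have : x ^ p - 1 = (x - 1) ^ p + p * ((x - 1) * r) := by rw [hr]; ring
    rw [this]
    refine dvd_add (pow_dvd_pow_of_dvd hx p) ?_
    rw [← Nat.sub_add_cancel hp.one_le, pow_succ, Nat.sub_add_cancel hp.one_le]
    exact mul_dvd_mul hassoc.dvd (hx.mul_right r)
  -- the valuation of `α` is divisible by `p`
  obtain ⟨m, α', hα', rfl⟩ := WfDvdMonoid.max_power_factor hα hl.irreducible
  obtain ⟨i, u', hu', rfl⟩ := WfDvdMonoid.max_power_factor hu hl.irreducible
  obtain ⟨j, v', hv', rfl⟩ := WfDvdMonoid.max_power_factor hv hl.irreducible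
  have hmul {x y : R} (hx : ¬ l ∣ x) (hy : ¬ l ∣ y) : ¬ l ∣ x * y := hl.not_dvd_mul hx hy
  have hpw {x : R} (hx : ¬ l ∣ x) (n : ℕ) : ¬ l ∣ x ^ n := fun hd ↦ hx (hl.dvd_of_dvd_pow hd)
  have h1 : l ^ (j * p + m) * (v' ^ p * (w ^ m * s α')) =
      l ^ (m * a + i * p) * (α' ^ a * u' ^ p) := by
    rw [map_mul, map_pow, hsl] at h
    simp only [mul_pow, ← pow_mul] at h
    rw [pow_add, pow_add]
    linear_combination h
  obtain ⟨h2, h3⟩ := hl.eq_and_eq_of_pow_mul_eq_pow_mul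
    (hmul (hpw hv' p) (hmul (hpw hw0 m) (hndvd hα'))) (hmul (hpw hα' a) (hpw hu' p)) h1
  obtain ⟨k, rfl⟩ : p ∣ m := by
    rw [← ZMod.natCast_eq_zero_iff]
    have h4 := congrArg (Nat.cast : ℕ → ZMod p) h2
    push_cast at h4
    rw [CharP.cast_eq_zero (ZMod p) p] at h4
    have h5 : (m : ZMod p) * ((a : ZMod p) - 1) = 0 := by linear_combination -h4
    exact (mul_eq_zero.mp h5).resolve_right (sub_ne_zero.mpr ha1)
  -- raising to the power `p - 1` makes all terms congruent to `1`
  set A := α' ^ (p - 1) with hA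
  have h4 : l ^ p ∣ s A - A ^ a := by
    have h5 := hpow (hfermat (hmul hv' (hpw hw0 k)))
    have h6 := hpow (hfermat hu')
    have h7 : ((v' * w ^ k) ^ (p - 1)) ^ p * s A = A ^ a * (u' ^ (p - 1)) ^ p := by
      have := congrArg (· ^ (p - 1)) h3
      simp only [mul_pow, ← pow_mul] at this
      rw [hA, map_pow]
      simp only [mul_pow, ← pow_mul]
      rw [show k * (p - 1) * p = p * k * (p - 1) by ring, show (p - 1) * p = p * (p - 1) by ring,
        show (p - 1) * a = a * (p - 1) by ring]
      linear_combination this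
    have h8 : s A - A ^ a = A ^ a * ((u' ^ (p - 1)) ^ p - 1) -
        s A * (((v' * w ^ k) ^ (p - 1)) ^ p - 1) := by linear_combination h7
    rw [h8]
    exact dvd_sub (h6.mul_left _) (h5.mul_left _)
  -- a power of `1 + l` removes the linear term
  obtain ⟨t, ht⟩ : l ∣ A - 1 := hfermat hα'
  obtain ⟨c, hc⟩ := hres t
  obtain ⟨b, hb⟩ : ∃ b : ℕ, (p : ℤ) ∣ b + c := by
    have hp0 : (p : ℤ) ≠ 0 := by exact_mod_cast hp.ne_zero
    refine ⟨((-c) % p).toNat, ?_⟩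
    rw [Int.toNat_of_nonneg (Int.emod_nonneg _ hp0)]
    have := Int.dvd_self_sub_of_emod_eq (a := -c) (b := p) rfl
    have h5 := (dvd_neg (a := (p : ℤ))).mpr this
    simpa using h5
  obtain ⟨g, hg, hgb⟩ := exists_one_add_pow_eq l b
  set β := A * (1 + l) ^ b with hβ
  have hβ2 : l ^ 2 ∣ β - 1 := by
    have h5 : l ∣ t + g := by
      have h6 := (hint _).mpr hb
      push_cast at h6
      have := (hc.add hgb).add h6
      simpa [sub_add_sub_comm, add_comm] using this
    have h6 : β - 1 = l * (t + g) + l ^ 2 * (t * g) := by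
      have : A = 1 + l * t := by rw [← ht]; ring
      rw [hβ, hg, this]; ring
    rw [h6, pow_two]
    exact dvd_add (mul_dvd_mul_left l h5) (dvd_mul_right _ _)
  have hsβ : l ^ p ∣ s β - β ^ a := by
    have h5 : s β - β ^ a = (s A - A ^ a) * ((1 + l) ^ a) ^ b := by
      rw [hβ, map_mul, map_pow s (1 + l) b, hs, mul_pow, pow_right_comm]; ring
    rw [h5]
    exact h4.mul_right _
  -- on `l ^ i / l ^ (i + 1)`, `s` acts by `a ^ i`, which differs from `a` for `1 < i < p`
  have key : ∀ i : ℕ, 2 ≤ i → i ≤ p → l ^ i ∣ β - 1 := by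
    intro i hi
    induction i, hi using Nat.le_induction with
    | base => exact fun _ ↦ hβ2
    | succ i hi ih =>
      intro hip
      obtain ⟨x, hx⟩ := ih (by omega)
      have hβx : β = 1 + l ^ i * x := by rw [← hx]; ring
      obtain ⟨g, hg, hga⟩ := exists_one_add_pow_eq (l ^ i * x) a
      have h5 : s β - β ^ a = l ^ i * (w ^ i * s x - x * g) := by
        rw [hβx, hg]; simp only [map_add, map_one, map_mul, map_pow, hsl, mul_pow]; ring
      have h6 : l ∣ w ^ i * s x - x * g := by
        have := (pow_dvd_pow l hip).trans hsβ
        rw [h5, pow_succ] at this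
        exact (mul_dvd_mul_iff_left (pow_ne_zero i hl.ne_zero)).mp this
      have h7 : l ∣ ((a : R) ^ i - a) * x := by
        have e1 : l ∣ g - a := (((dvd_pow_self l (by omega)).mul_right x)).trans hga
        have e2 : l ∣ w ^ i - (a : R) ^ i := hwa.trans (sub_dvd_pow_sub_pow _ _ _)
        have e3 : ((a : R) ^ i - a) * x = (w ^ i * s x - x * g) - (w ^ i - (a : R) ^ i) * x
          - w ^ i * (s x - x) + x * (g - a) := by ring
        rw [e3]
        exact dvd_add (dvd_sub (dvd_sub h6 (e2.mul_right x)) ((hsx x).mul_left _))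
          (e1.mul_left x)
      rcases hl.dvd_or_dvd h7 with h8 | h8
      · exfalso
        rw [show (a : R) ^ i - a = (((a : ℤ) ^ i - a : ℤ) : R) by push_cast; rfl, hint,
          ← ZMod.intCast_zmod_eq_zero_iff_dvd] at h8
        push_cast at h8
        have h9 : (a : ZMod p) ^ (i - 1) = 1 := by
          apply mul_right_cancel₀ haz
          rw [← pow_succ, Nat.sub_add_cancel (by omega), one_mul]
          exact sub_eq_zero.mp h8
        have h10 := Nat.le_of_dvd (by omega) (orderOf_dvd_of_pow_eq_one h9)
        omega
      · rw [hx, pow_succ]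
        exact mul_dvd_mul_left _ h8
  obtain ⟨x, hx⟩ := key p (by omega) le_rfl
  refine ⟨b, k * (p - 1), x, ?_⟩
  have hβx : β = 1 + x * l ^ p := by rw [mul_comm x, ← hx]; ring
  rw [← hβx, hβ, hA, mul_pow, ← pow_mul]
  ring

/-! ### Lagrange resolvents -/

lemma sum_range_add_eq_of_periodic {R : Type*} [AddCommMonoid R] {F : ℕ → R} {n : ℕ}
    (hF : Function.Periodic F n) (k : ℕ) :
    ∑ i ∈ Finset.range n, F (i + k) = ∑ i ∈ Finset.range n, F i := by
  induction k with
  | zero => simp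
  | succ k ih =>
    rw [← ih]
    cases n with
    | zero => simp
    | succ n =>
      rw [Finset.sum_range_succ, Finset.sum_range_succ' (fun i ↦ F (i + k))]
      congr 1
      · exact Finset.sum_congr rfl fun i _ ↦ by rw [add_assoc, add_comm 1 k]
      · rw [show n + (k + 1) = 0 + k + (n + 1) by omega]
        exact hF _

/-- A Lagrange resolvent `θ = ∑ ζ ^ (-i) s ^ i x` of a cyclic extension `L / ℚ` of prime degree,
where `s` generates the Galois group: a Kummer generator for `L(ζ) / ℚ(ζ)`. -/
theorem exists_lagrange_resolvent {ℓ : ℕ} (hℓ : ℓ.Prime) {ζ : M} (hζ : IsPrimitiveRoot ζ ℓ)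
    (L : IntermediateField ℚ M) [IsGalois ℚ L] (hL : Module.finrank ℚ L = ℓ) :
    ∃ θ : 𝓞 M, θ ≠ 0 ∧ ∀ τ : Gal(M/ℚ), τ ζ = ζ →
      ∃ k : ℕ, τ (θ : M) = ζ ^ k * θ ∧ (ℓ ∣ k → ∀ x ∈ L, τ x = x) := by
  have : Fact ℓ.Prime := ⟨hℓ⟩
  have hcard : Nat.card Gal(L/ℚ) = ℓ := by rw [IsGalois.card_aut_eq_finrank, hL]
  have hnt : Nontrivial Gal(L/ℚ) := by
    rw [← Finite.one_lt_card_iff_nontrivial, hcard]; exact hℓ.one_lt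
  obtain ⟨s, hs⟩ := exists_ne (1 : Gal(L/ℚ))
  have hord : orderOf s = ℓ := orderOf_eq_prime (by rw [← hcard, pow_card_eq_one']) hs
  have hgen (σ : Gal(L/ℚ)) : ∃ k : ℕ, s ^ k = σ := by
    exact mem_powers_of_prime_card (G := Gal(L/ℚ)) hcard hs (g' := σ)
  have hζ0 : ζ ≠ 0 := hζ.ne_zero hℓ.ne_zero
  -- some resolvent is nonzero, by Dedekind's independence of the embeddings `s ^ i`
  obtain ⟨x, hx⟩ : ∃ x : L, ∑ i ∈ Finset.range ℓ, (ζ⁻¹) ^ i * ((s ^ i) x : M) ≠ 0 := by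
    by_contra! hall
    let χ : Fin ℓ → (L →* M) := fun i ↦
      ((L.val : L →+* M).comp ((s ^ (i : ℕ) : Gal(L/ℚ)) : L →+* L) : L →* M)
    have hχ : Function.Injective χ := by
      intro i j hij
      have h1 : s ^ (i : ℕ) = s ^ (j : ℕ) := by
        ext y
        exact DFunLike.congr_fun hij y
      have := pow_injOn_Iio_orderOf (x := s) (by simp [hord]) (by simp [hord]) h1
      exact Fin.ext this
    have hli := (linearIndependent_monoidHom L M).comp χ hχ
    rw [Fintype.linearIndependent_iff] at hli
    have h0 := hli (fun i ↦ (ζ⁻¹) ^ (i : ℕ)) (by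
      ext y
      rw [Finset.sum_apply, Pi.zero_apply, ← hall y, Finset.sum_range]
      rfl) ⟨0, hℓ.pos⟩
    simp at h0
  set θ₀ : M := ∑ i ∈ Finset.range ℓ, (ζ⁻¹) ^ i * ((s ^ i) x : M) with hθ₀
  obtain ⟨n, hn0, hn⟩ : ∃ n : ℤ, n ≠ 0 ∧ IsIntegral ℤ ((n : M) * θ₀) := by
    obtain ⟨n, hn0, hn⟩ := ((IsFractionRing.isAlgebraic_iff ℤ ℚ M).mpr
      (Algebra.IsAlgebraic.isAlgebraic (R := ℚ) θ₀)).exists_integral_multiple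
    exact ⟨n, hn0, by rwa [zsmul_eq_mul] at hn⟩
  refine ⟨⟨n * θ₀, hn⟩, ?_, ?_⟩
  · intro h
    have h1 : (n : M) * θ₀ = 0 := congrArg (fun z : 𝓞 M ↦ (z : M)) h
    exact hx ((mul_eq_zero.mp h1).resolve_left (by exact_mod_cast hn0))
  · intro τ hτ
    obtain ⟨k, hk⟩ := hgen (τ.restrictNormal L)
    have hkx (y : L) : τ (y : M) = ((s ^ k) y : L) := by
      rw [hk]
      exact (AlgEquiv.restrictNormal_commutes τ L y).symm
    refine ⟨k, ?_, ?_⟩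
    · change τ (n * θ₀) = ζ ^ k * (n * θ₀)
      have h1 : τ θ₀ = ζ ^ k * θ₀ := by
        have hper : Function.Periodic (fun i ↦ (ζ⁻¹) ^ i * ((s ^ i) x : M)) ℓ := by
          intro i
          have e1 : (ζ⁻¹) ^ ℓ = 1 := by rw [inv_pow, hζ.pow_eq_one, inv_one]
          have e2 : s ^ ℓ = 1 := by rw [← hord, pow_orderOf_eq_one]
          simp only [pow_add, e1, e2, mul_one]
        have hτ' : τ ζ⁻¹ = ζ⁻¹ := by rw [map_inv₀, hτ]
        rw [hθ₀]
        conv_rhs => rw [← sum_range_add_eq_of_periodic hper k]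
        rw [map_sum, Finset.mul_sum]
        refine Finset.sum_congr rfl fun i _ ↦ ?_
        rw [map_mul, map_pow, hτ', hkx, ← AlgEquiv.mul_apply, ← pow_add, add_comm k i,
          pow_add ζ⁻¹, inv_pow ζ k]
        field_simp
      rw [map_mul, map_intCast, h1]
      ring
    · rintro ⟨j, rfl⟩ y hy
      have := hkx ⟨y, hy⟩
      rw [pow_mul, ← hord, pow_orderOf_eq_one, one_pow] at this
      exact this

lemma mem_adjoin_simple_of_forall_apply_eq [IsGalois ℚ M] {ζ x : M}
    (h : ∀ τ : Gal(M/ℚ), τ ζ = ζ → τ x = x) : x ∈ ℚ⟮ζ⟯ := by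
  rw [← IsGalois.fixedField_fixingSubgroup ℚ⟮ζ⟯, IntermediateField.mem_fixedField_iff]
  intro f hf
  exact h f ((IntermediateField.mem_fixingSubgroup_iff _ _).mp hf ζ
    (IntermediateField.mem_adjoin_simple_self ℚ ζ))

lemma apply_eq_of_mem_adjoin_simple {ζ x : M} {τ : Gal(M/ℚ)} (hτ : τ ζ = ζ) (hx : x ∈ ℚ⟮ζ⟯) :
    τ x = x := by
  have h : ℚ⟮ζ⟯ ≤ IntermediateField.fixedField (Subgroup.zpowers τ) := by
    rw [IntermediateField.adjoin_simple_le_iff, IntermediateField.mem_fixedField_iff]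
    intro f hf
    have : Subgroup.zpowers τ ≤ MulAction.stabilizer Gal(M/ℚ) ζ := by
      rw [Subgroup.zpowers_le]; exact hτ
    exact this hf
  exact (IntermediateField.mem_fixedField_iff _ _).mp (h hx) τ (Subgroup.mem_zpowers τ)

lemma exists_primitive_root_natCast {p : ℕ} (hp : p.Prime) :
    ∃ a : ℕ, a.Coprime p ∧ orderOf (a : ZMod p) = p - 1 := by
  have : Fact p.Prime := ⟨hp⟩
  obtain ⟨u, hu⟩ := IsCyclic.exists_generator (α := (ZMod p)ˣ)
  refine ⟨(u : ZMod p).val, ZMod.val_coe_unit_coprime u, ?_⟩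
  rw [ZMod.natCast_zmod_val, orderOf_units, orderOf_eq_card_of_forall_mem_zpowers hu,
    Nat.card_eq_fintype_card, ZMod.card_units]

lemma exists_apply_eq_pow_of_coprime [IsGalois ℚ M] {n : ℕ} (hn : 0 < n) {ζ : M}
    (hζ : IsPrimitiveRoot ζ n) {a : ℕ} (ha : a.Coprime n) : ∃ g : Gal(M/ℚ), g ζ = ζ ^ a := by
  have h : IsConjRoot ℚ (ζ ^ a) ζ := by
    rw [IsConjRoot, ← Polynomial.cyclotomic_eq_minpoly_rat hζ hn,
      ← Polynomial.cyclotomic_eq_minpoly_rat (hζ.pow_of_coprime a ha) hn]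
  obtain ⟨g, hg⟩ := (isConjRoot_iff_exists_algEquiv).mp h
  exact ⟨g, hg⟩

/-! ### Wild inertia -/

lemma exists_int_zeta_sub_one_dvd_sub {E : Type*} [Field E] [NumberField E] {p : ℕ}
    [hp : Fact p.Prime] [IsCyclotomicExtension {p} ℚ E] {ζ : E} (hζ : IsPrimitiveRoot ζ p)
    (x : 𝓞 E) : ∃ n : ℤ, hζ.toInteger - 1 ∣ x - n := by
  have hcard : Nat.card (𝓞 E ⧸ Ideal.span {hζ.toInteger - 1}) = p := by
    have : IsCyclotomicExtension {p ^ (0 + 1)} ℚ E := by simpa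
    have h := IsCyclotomicExtension.Rat.absNorm_span_zeta_sub_one p 0
      (show IsPrimitiveRoot ζ (p ^ (0 + 1)) by simpa)
    have e : (show IsPrimitiveRoot ζ (p ^ (0 + 1)) by simpa).toInteger = hζ.toInteger := rfl
    rwa [e, Ideal.absNorm_apply, Submodule.cardQuot_apply] at h
  have h1 : (1 : 𝓞 E ⧸ Ideal.span {hζ.toInteger - 1}) ≠ 0 := by
    have : Nontrivial (𝓞 E ⧸ Ideal.span {hζ.toInteger - 1}) := by
      have := Nat.finite_of_card_ne_zero (hcard ▸ hp.out.ne_zero)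
      rw [← Finite.one_lt_card_iff_nontrivial, hcard]
      exact hp.out.one_lt
    exact one_ne_zero
  have htop := zmultiples_eq_top_of_prime_card hcard h1
  have hmem : Ideal.Quotient.mk (Ideal.span {hζ.toInteger - 1}) x ∈
      AddSubgroup.zmultiples (1 : 𝓞 E ⧸ Ideal.span {hζ.toInteger - 1}) := by
    rw [htop]; trivial
  obtain ⟨n, hn⟩ := AddSubgroup.mem_zmultiples_iff.mp hmem
  refine ⟨n, ?_⟩
  rw [← Ideal.mem_span_singleton, ← Ideal.Quotient.eq, ← hn]
  simp

/-- For odd `ℓ`, a Kummer generator `θ` over `ℚ(ζ)` inside an abelian extension of `ℚ` satisfies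
`θ ^ (ℓ * (ℓ - 1)) ≡ 1` modulo `(ζ - 1) ^ ℓ`, up to powers of `ζ` and of `(ζ - 1) ^ ℓ`. If
`g ζ = ζ ^ a`, then commutativity forces `g θ / θ ^ a ∈ ℚ(ζ)`, so `α = θ ^ ℓ` is an eigenvector of
`g` modulo `ℓ`-th powers, and `exists_pow_mul_eq_one_add_of_eigenvector` applies to it. -/
theorem exists_pow_eq_one_add_of_odd [IsGalois ℚ M]
    (hcomm : ∀ σ τ : Gal(M/ℚ), σ * τ = τ * σ) {ℓ : ℕ} (hℓ : ℓ.Prime) (hℓ2 : ℓ ≠ 2) {ζ : M}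
    (hζ : IsPrimitiveRoot ζ ℓ) {θ : 𝓞 M} (hθ0 : θ ≠ 0)
    (hθ : ∀ τ : Gal(M/ℚ), τ ζ = ζ → ∃ k : ℕ, τ (θ : M) = ζ ^ k * θ) :
    ∃ b k : ℕ, ∃ x : 𝓞 M, ((θ : M) ^ ℓ) ^ (ℓ - 1) * ζ ^ b =
      (ζ - 1) ^ (ℓ * k) * (1 + x * (ζ - 1) ^ ℓ) := by
  have : Fact ℓ.Prime := ⟨hℓ⟩
  have : NeZero ℓ := ⟨hℓ.ne_zero⟩
  let E : IntermediateField ℚ M := ℚ⟮ζ⟯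
  have : IsCyclotomicExtension {ℓ} ℚ E := hζ.intermediateField_adjoin_isCyclotomicExtension ℚ
  have : IsGalois ℚ E := IsCyclotomicExtension.isGalois {ℓ} ℚ E
  have hθM : (θ : M) ≠ 0 := fun h ↦ hθ0 (RingOfIntegers.ext h)
  let z : E := ⟨ζ, IntermediateField.mem_adjoin_simple_self ℚ ζ⟩
  have hz : IsPrimitiveRoot z ℓ := by
    apply IsPrimitiveRoot.of_map_of_injective (f := algebraMap E M) hζ
    exact (algebraMap E M).injective
  obtain ⟨a, hac, ha⟩ := exists_primitive_root_natCast hℓ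
  obtain ⟨g, hg⟩ := exists_apply_eq_pow_of_coprime hℓ.pos hζ hac
  have hgθ (τ : Gal(M/ℚ)) (hτ : τ ζ = ζ) : τ (g θ / θ ^ a : M) = g θ / θ ^ a := by
    obtain ⟨k, hk⟩ := hθ τ hτ
    have h1 : τ (g θ) = (ζ ^ k) ^ a * g θ := by
      rw [← AlgEquiv.mul_apply, hcomm, AlgEquiv.mul_apply, hk, map_mul, map_pow, hg,
        pow_right_comm]
    have hzk : (ζ ^ k) ^ a ≠ 0 := pow_ne_zero _ (pow_ne_zero _ (hζ.ne_zero hℓ.ne_zero))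
    rw [map_div₀, map_pow, h1, hk, mul_pow, mul_div_mul_left _ _ hzk]
  have hαθ (τ : Gal(M/ℚ)) (hτ : τ ζ = ζ) : τ ((θ : M) ^ ℓ) = (θ : M) ^ ℓ := by
    obtain ⟨k, hk⟩ := hθ τ hτ
    rw [map_pow, hk, mul_pow, pow_right_comm, hζ.pow_eq_one, one_pow, one_mul]
  obtain ⟨c, hc⟩ : ∃ c : E, (c : M) = g θ / θ ^ a :=
    ⟨⟨_, mem_adjoin_simple_of_forall_apply_eq hgθ⟩, rfl⟩
  obtain ⟨α, hα⟩ : ∃ α : 𝓞 E, ((α : E) : M) = (θ : M) ^ ℓ := by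
    let α₀ : E := ⟨(θ : M) ^ ℓ, mem_adjoin_simple_of_forall_apply_eq hαθ⟩
    have : IsIntegral ℤ α₀ := by
      rw [← isIntegral_algebraMap_iff (B := M) (algebraMap E M).injective]
      exact (RingOfIntegers.isIntegral_coe θ).pow ℓ
    exact ⟨⟨α₀, this⟩, rfl⟩
  obtain ⟨u, v, hv, huv⟩ := IsFractionRing.div_surjective (𝓞 E) c
  let s : 𝓞 E →+* 𝓞 E := MulSemiringAction.toRingHom Gal(E/ℚ) (𝓞 E) (g.restrictNormal E)
  have hs (y : 𝓞 E) : (((s y : 𝓞 E) : E) : M) = g ((y : E) : M) :=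
    AlgEquiv.restrictNormal_commutes g E y
  have hinj {y y' : 𝓞 E} (h : ((y : E) : M) = ((y' : E) : M)) : y = y' :=
    RingOfIntegers.ext (Subtype.ext h)
  have hv0 : v ≠ 0 := nonZeroDivisors.ne_zero hv
  have hvM : ((v : E) : M) ≠ 0 := fun h ↦ hv0 (hinj h)
  have hcM : (c : M) * ((v : E) : M) = ((u : E) : M) := by
    rw [← huv]
    have : (((v : E)) : M) ≠ 0 := hvM
    change (((u : E) : M) / ((v : E) : M)) * ((v : E) : M) = _
    field_simp
  have hc0 : (c : M) ≠ 0 := by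
    rw [hc]
    exact div_ne_zero (by simpa using hθM) (pow_ne_zero _ hθM)
  have hu0 : u ≠ 0 := by
    rintro rfl
    exact (mul_ne_zero hc0 hvM) hcM
  have hα0 : α ≠ 0 := by
    rintro rfl
    exact (pow_ne_zero ℓ hθM) hα.symm
  have hrel : v ^ ℓ * s α = α ^ a * u ^ ℓ := by
    apply hinj
    have e1 : (((v ^ ℓ * s α : 𝓞 E) : E) : M) = ((v : E) : M) ^ ℓ * g ((α : E) : M) := by
      rw [← hs]; rfl
    have e2 : (((α ^ a * u ^ ℓ : 𝓞 E) : E) : M) = ((α : E) : M) ^ a * ((u : E) : M) ^ ℓ := rfl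
    have e3 : (θ : M) ^ a * (g θ / θ ^ a * ((v : E) : M)) = g θ * ((v : E) : M) := by
      field_simp
    rw [e1, e2, ← hcM, hc, hα, map_pow, pow_right_comm, ← mul_pow, ← mul_pow, e3, mul_comm]
  have hZ : (1 : 𝓞 E) + (hz.toInteger - 1) = hz.toInteger := by ring
  obtain ⟨b, k, x, hx⟩ := exists_pow_mul_eq_one_add_of_eigenvector
    (l := hz.toInteger - 1) hz.zeta_sub_one_prime' hℓ hℓ2
    (IsCyclotomicExtension.Rat.associated_zeta_sub_one_pow_prime ℓ hz)
    (exists_int_zeta_sub_one_dvd_sub hz) s ha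
    (by
      rw [hZ]
      apply hinj
      rw [hs]
      exact hg) hα0 hu0 hv0 hrel
  refine ⟨b, k, algebraMap (𝓞 E) (𝓞 M) x, ?_⟩
  have h := congrArg (fun y : 𝓞 E ↦ ((y : E) : M)) hx
  rw [hZ] at h
  rw [← hα]
  exact h

/-- The field of eighth roots of unity contains square roots of `-1` and `2`, so that every nonzero
integer becomes congruent to `1` modulo `4` after multiplication by a square from that field. -/
theorem exists_sq_mul_eq_one_add {ξ : M} (hξ : IsPrimitiveRoot ξ 8) {d : ℤ} (hd : d ≠ 0) :
    ∃ c ∈ ℚ⟮ξ⟯, c ≠ 0 ∧ ∃ x : ℤ, c ^ 2 * d = 1 + x * 4 := by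
  have h4 : ξ ^ 4 = -1 := (hξ.pow (by norm_num) (by norm_num : 8 = 4 * 2)).eq_neg_one_of_two_right
  have hr : (ξ - ξ ^ 3) ^ 2 = 2 := by linear_combination (ξ ^ 2 - 2) * h4
  have hξ0 : ξ ≠ 0 := hξ.ne_zero (by norm_num)
  have hr0 : ξ - ξ ^ 3 ≠ 0 := fun h ↦ by rw [h] at hr; norm_num at hr
  have hmem : ξ ∈ ℚ⟮ξ⟯ := IntermediateField.mem_adjoin_simple_self ℚ ξ
  obtain ⟨m, e, he, rfl⟩ := WfDvdMonoid.max_power_factor hd Int.prime_two.irreducible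
  have hrm : ((ξ - ξ ^ 3) / 2) ^ m ∈ ℚ⟮ξ⟯ :=
    pow_mem (div_mem (sub_mem hmem (pow_mem hmem 3)) (ofNat_mem _ 2)) m
  have hrm0 : ((ξ - ξ ^ 3) / 2) ^ m ≠ 0 := pow_ne_zero _ (div_ne_zero hr0 two_ne_zero)
  have hrm2 : (((ξ - ξ ^ 3) / 2) ^ m) ^ 2 * ((2 ^ m * e : ℤ) : M) = e := by
    rw [pow_right_comm, div_pow, hr]
    push_cast
    rw [← mul_assoc, ← mul_pow]
    norm_num
  have hcases : e % 4 = 1 ∨ e % 4 = 3 := by omega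
  rcases hcases with h | h
  · refine ⟨((ξ - ξ ^ 3) / 2) ^ m, hrm, hrm0, e / 4, ?_⟩
    rw [hrm2]
    have : e = 1 + e / 4 * 4 := by omega
    exact_mod_cast congrArg (Int.cast : ℤ → M) this
  · refine ⟨ξ ^ 2 * ((ξ - ξ ^ 3) / 2) ^ m, mul_mem (pow_mem hmem 2) hrm,
      mul_ne_zero (pow_ne_zero 2 hξ0) hrm0, -(e / 4) - 1, ?_⟩
    have : -e = 1 + (-(e / 4) - 1) * 4 := by omega
    rw [mul_pow, mul_assoc, hrm2, ← pow_mul, h4, neg_one_mul]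
    exact_mod_cast congrArg (Int.cast : ℤ → M) this

/-- An inertia element at `ℓ` that fixes the `ℓ ^ 3`-th roots of unity acts trivially on every
Galois extension `L` of `ℚ` of degree `ℓ`: some Kummer generator of `L(ξ)` over `ℚ(ξ)` has `ℓ`-th
power congruent to `1` modulo `(ζ - 1) ^ ℓ`. For odd `ℓ` the roots of unity of order `ℓ ^ 2` would
suffice; for `ℓ = 2` those of order `8` are needed. -/
theorem inertia_apply_eq_of_mem [IsGalois ℚ M]
    (hcomm : ∀ σ τ : Gal(M/ℚ), σ * τ = τ * σ) {ℓ : ℕ} (hℓ : ℓ.Prime) {ξ : M}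
    (hξ : IsPrimitiveRoot ξ (ℓ ^ 3)) (L : IntermediateField ℚ M) [IsGalois ℚ L]
    (hL : Module.finrank ℚ L = ℓ) {P : Ideal (𝓞 M)} [P.IsPrime] (hℓP : (ℓ : 𝓞 M) ∈ P)
    {τ : Gal(M/ℚ)} (hτ : τ ∈ P.inertia Gal(M/ℚ)) (hτξ : τ ξ = ξ) {x : M} (hx : x ∈ L) :
    τ x = x := by
  have hζ : IsPrimitiveRoot (ξ ^ ℓ ^ 2) ℓ := hξ.pow (pow_pos hℓ.pos 3) (by ring)
  have hξ1 : IsPrimitiveRoot (ξ ^ ℓ) (ℓ ^ 2) := hξ.pow (pow_pos hℓ.pos 3) (by ring)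
  set ζ := ξ ^ ℓ ^ 2 with hζdef
  have hτζ : τ ζ = ζ := by rw [hζdef, map_pow, hτξ]
  obtain ⟨θ, hθ0, hθ⟩ := exists_lagrange_resolvent hℓ hζ L hL
  have hθM : (θ : M) ≠ 0 := fun h ↦ hθ0 (RingOfIntegers.ext h)
  have hθℓ (σ : Gal(M/ℚ)) (hσ : σ ζ = ζ) : σ ((θ : M) ^ ℓ) = (θ : M) ^ ℓ := by
    obtain ⟨k, hk, -⟩ := hθ σ hσ
    rw [map_pow, hk, mul_pow, pow_right_comm, hζ.pow_eq_one, one_pow, one_mul]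
  suffices h : τ (θ : M) = θ by
    obtain ⟨k, hk, hkL⟩ := hθ τ hτζ
    refine hkL ((hζ.pow_eq_one_iff_dvd k).mp ?_) x hx
    rw [h] at hk
    exact (mul_right_cancel₀ hθM ((one_mul (θ : M)).trans hk)).symm
  by_cases hℓ2 : ℓ = 2
  -- for `ℓ = 2`, `θ ^ 2` is an integer and the condition reads `1 + 4 x`, as `ζ - 1 = -2`
  · subst hℓ2
    have hζ1 : ζ = -1 := hζ.eq_neg_one_of_two_right
    have hrat : ∃ d : ℤ, (θ : M) ^ 2 = d := by
      have h1 : (θ : M) ^ 2 ∈ (⊥ : IntermediateField ℚ M) :=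
        (IsGalois.mem_bot_iff_fixed _).mpr fun σ ↦ hθℓ σ (by rw [hζ1]; simp)
      obtain ⟨q, hq⟩ := IntermediateField.mem_bot.mp h1
      have h2 : IsIntegral ℤ q := by
        rw [← isIntegral_algebraMap_iff (B := M) (algebraMap ℚ M).injective, hq]
        exact (RingOfIntegers.isIntegral_coe θ).pow 2
      obtain ⟨d, hd⟩ := IsIntegrallyClosed.isIntegral_iff.mp h2
      exact ⟨d, by rw [← hq, ← hd]; simp⟩
    obtain ⟨d, hd⟩ := hrat
    have hd0 : d ≠ 0 := by
      rintro rfl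
      rw [Int.cast_zero] at hd
      exact pow_ne_zero 2 hθM hd
    obtain ⟨c, hc, hc0, y, hy⟩ := exists_sq_mul_eq_one_add (ξ := ξ) (by simpa using hξ) hd0
    have hτc : τ c = c := apply_eq_of_mem_adjoin_simple hτξ hc
    have hη := inertia_apply_eq_of_pow_eq_one_add hℓ hζ hℓP hτ hτζ (η := c * θ) (x := (y : 𝓞 M))
      (by rw [map_mul, mul_pow, mul_pow, hτc, ← map_pow, hθℓ τ hτζ])
      (by rw [mul_pow, hd, hy, hζ1]; norm_num)
    rw [map_mul, hτc] at hη
    exact mul_left_cancel₀ hc0 hη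
  · obtain ⟨b, k, y, hy⟩ := exists_pow_eq_one_add_of_odd hcomm hℓ hℓ2 hζ hθ0
      (fun σ hσ ↦ (hθ σ hσ).imp fun _ h ↦ h.1)
    have hl0 : ζ - 1 ≠ 0 := sub_ne_zero.mpr (hζ.ne_one hℓ.one_lt)
    have hξ0 : ξ ≠ 0 := hξ.ne_zero (pow_ne_zero 3 hℓ.ne_zero)
    -- `c ^ ℓ = ζ ^ b / (ζ - 1) ^ (ℓ * k)`, and `c θ ^ (ℓ - 1)` is the normalized generator
    set c : M := (ξ ^ ℓ) ^ b / (ζ - 1) ^ k with hc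
    have hτc : τ c = c := by
      rw [hc]; simp only [map_div₀, map_pow, map_sub, map_one, hτζ, hτξ]
    have hc0 : c ≠ 0 := div_ne_zero (pow_ne_zero _ (pow_ne_zero _ hξ0)) (pow_ne_zero _ hl0)
    have hη := inertia_apply_eq_of_pow_eq_one_add hℓ hζ hℓP hτ hτζ
      (η := c * (θ : M) ^ (ℓ - 1)) (x := y)
      (by
        rw [map_mul, mul_pow, mul_pow, hτc, map_pow, pow_right_comm, ← map_pow, hθℓ τ hτζ,
          pow_right_comm])
      (by
        have e : (c * (θ : M) ^ (ℓ - 1)) ^ ℓ =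
            ((θ : M) ^ ℓ) ^ (ℓ - 1) * ζ ^ b / (ζ - 1) ^ (ℓ * k) := by
          rw [hc, hζdef]; ring
        rw [e, hy, mul_div_cancel_left₀ _ (pow_ne_zero _ hl0)])
    rw [map_mul, hτc] at hη
    have h1 : τ ((θ : M) ^ (ℓ - 1)) = (θ : M) ^ (ℓ - 1) := mul_left_cancel₀ hc0 hη
    have h2 := hθℓ τ hτζ
    rw [← Nat.sub_add_cancel hℓ.one_le, pow_succ, map_mul, h1] at h2
    exact mul_left_cancel₀ (pow_ne_zero _ hθM) h2

/-! ### Composita with cyclotomic fields: counting inertia -/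

lemma gal_eq_of_sup_adjoin_eq_top {L : IntermediateField ℚ M} {ξ : M} (hsup : L ⊔ ℚ⟮ξ⟯ = ⊤)
    {σ τ : Gal(M/ℚ)} (hL : ∀ x ∈ L, σ x = τ x) (hξ : σ ξ = τ ξ) : σ = τ := by
  have hξ' : (τ⁻¹ * σ) ξ = ξ := by
    rw [AlgEquiv.mul_apply, hξ, ← AlgEquiv.mul_apply, inv_mul_cancel, AlgEquiv.one_apply]
  have hle : L ⊔ ℚ⟮ξ⟯ ≤ IntermediateField.fixedField (Subgroup.zpowers (τ⁻¹ * σ)) := by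
    refine sup_le (fun x hx ↦ ?_) (fun x hx ↦ ?_) <;>
      rw [IntermediateField.mem_fixedField_iff] <;> intro f hf
    · have : Subgroup.zpowers (τ⁻¹ * σ) ≤ MulAction.stabilizer Gal(M/ℚ) x := by
        rw [Subgroup.zpowers_le, MulAction.mem_stabilizer_iff]
        change (τ⁻¹ * σ) x = x
        rw [AlgEquiv.mul_apply, hL x hx, ← AlgEquiv.mul_apply, inv_mul_cancel, AlgEquiv.one_apply]
      exact this hf
    · have : Subgroup.zpowers (τ⁻¹ * σ) ≤ MulAction.stabilizer Gal(M/ℚ) x := by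
        rw [Subgroup.zpowers_le, MulAction.mem_stabilizer_iff]
        exact apply_eq_of_mem_adjoin_simple hξ' hx
      exact this hf
  rw [hsup] at hle
  refine (inv_mul_eq_one.mp (AlgEquiv.ext fun x ↦ ?_)).symm
  exact (IntermediateField.mem_fixedField_iff _ _).mp (hle IntermediateField.mem_top) _
    (Subgroup.mem_zpowers _)

lemma restrictNormal_apply_coe (E : IntermediateField ℚ M) [Normal ℚ E] (σ : Gal(M/ℚ)) (x : E) :
    ((AlgEquiv.restrictNormalHom E σ x : E) : M) = σ x :=
  AlgEquiv.restrictNormal_commutes σ E x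

lemma pow_finrank_apply_eq (E : IntermediateField ℚ M) [IsGalois ℚ E] (σ : Gal(M/ℚ)) {n : ℕ}
    (hn : Module.finrank ℚ E ∣ n) {x : M} (hx : x ∈ E) : (σ ^ n) x = x := by
  have h : AlgEquiv.restrictNormalHom E (σ ^ n) = 1 := by
    obtain ⟨k, rfl⟩ := hn
    rw [map_pow, pow_mul, ← IsGalois.card_aut_eq_finrank, pow_card_eq_one', one_pow]
  have := restrictNormal_apply_coe E (σ ^ n) ⟨x, hx⟩
  rw [h] at this
  exact this.symm

/-- A root of unity of order `a * b`, with `a` and `b` coprime, is determined by its powers of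
orders `a` and `b`. -/
lemma apply_eq_of_coprime {ξ : M} (hξ0 : ξ ≠ 0) {a b : ℕ} (hab : a.Coprime b) {σ : Gal(M/ℚ)}
    (ha : σ (ξ ^ a) = ξ ^ a) (hb : σ (ξ ^ b) = ξ ^ b) : σ ξ = ξ := by
  obtain ⟨u, v, huv⟩ := Nat.isCoprime_iff_coprime.mpr hab
  have h : ξ = (ξ ^ a) ^ u * (ξ ^ b) ^ v := by
    rw [← zpow_natCast, ← zpow_natCast, ← zpow_mul, ← zpow_mul, ← zpow_add₀ hξ0,
      mul_comm (a : ℤ), mul_comm (b : ℤ), huv, zpow_one]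
  conv_lhs => rw [h]
  rw [map_mul, map_zpow₀, map_zpow₀, ha, hb, ← h]

lemma inertia_apply_eq_of_pow_eq_one {P : Ideal (𝓞 M)} {σ : Gal(M/ℚ)}
    (hσ : σ ∈ P.inertia Gal(M/ℚ)) {m : ℕ} (hm : (m : 𝓞 M) ∉ P) {z : M} (hz : z ^ m = 1) :
    σ z = z := by
  have hm0 : 0 < m := Nat.pos_of_ne_zero (by rintro rfl; simp at hm)
  have hint : IsIntegral ℤ z := (by rw [hz]; exact isIntegral_one : IsIntegral ℤ (z ^ m)).of_pow hm0
  exact congrArg (fun y : 𝓞 M ↦ (y : M))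
    (inertia_smul_eq_of_pow_eq_one (z := ⟨z, hint⟩) hσ hm (RingOfIntegers.ext hz))

/-- Inertia acts trivially on a subfield whose discriminant is prime to `p`. -/
lemma inertia_apply_eq_of_not_dvd_discr (L : IntermediateField ℚ M) [IsGalois ℚ L] {p : ℕ}
    (hp : p.Prime) (hd : ¬ (p : ℤ) ∣ discr L) {P : Ideal (𝓞 M)} [P.IsPrime]
    (hpP : (p : 𝓞 M) ∈ P) {σ : Gal(M/ℚ)} (hσ : σ ∈ P.inertia Gal(M/ℚ)) {x : M} (hx : x ∈ L) :
    σ x = x := by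
  have hpZ := Nat.prime_iff_prime_int.mp hp
  rw [not_dvd_discr_iff_isUnramifiedIn L (𝓞 L) hpZ] at hd
  let Q : Ideal (𝓞 L) := P.under (𝓞 L)
  have hpQ : (p : 𝓞 L) ∈ Q := by simpa [Q] using hpP
  have hQ : Q.LiesOver (Ideal.span {(p : ℤ)}) :=
    (Ideal.liesOver_span_iff Ideal.IsPrime.ne_top' hpZ).mpr (by simpa using hpQ)
  have hunr : Algebra.IsUnramifiedAt ℤ Q := hd Q inferInstance hQ
  have : Fact p.Prime := ⟨hp⟩
  have hmax : (Ideal.span {(p : ℤ)}).IsMaximal := Int.ideal_span_isMaximal_of_prime p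
  have hfin : Finite (ℤ ⧸ Ideal.span {(p : ℤ)}) :=
    Ring.HasFiniteQuotients.finiteQuotient (by simpa using hp.ne_zero)
  have h1 := Ideal.card_inertia_eq_ramificationIdxIn (G := Gal(L/ℚ)) (Ideal.span {(p : ℤ)}) Q
  rw [Ideal.ramificationIdxIn_eq_ramificationIdx _ Q Gal(L/ℚ),
    Ideal.ramificationIdx_eq_one_iff.mpr hunr, Subgroup.card_eq_one] at h1
  have h2 : AlgEquiv.restrictNormalHom L σ ∈ Q.inertia Gal(L/ℚ) := by
    intro y
    change algebraMap (𝓞 L) (𝓞 M) (AlgEquiv.restrictNormalHom L σ • y - y) ∈ P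
    have h3 : algebraMap (𝓞 L) (𝓞 M) (AlgEquiv.restrictNormalHom L σ • y - y) =
        σ • algebraMap (𝓞 L) (𝓞 M) y - algebraMap (𝓞 L) (𝓞 M) y := by
      rw [map_sub]
      congr 1
      exact RingOfIntegers.ext (restrictNormal_apply_coe L σ y)
    rw [h3]
    exact hσ _
  rw [h1, Subgroup.mem_bot] at h2
  have h3 := restrictNormal_apply_coe L σ ⟨x, hx⟩
  rw [h2] at h3
  exact h3.symm

open scoped Pointwise in
lemma natCard_sup_le {G : Type*} [Group G] [Finite G] (A B : Subgroup G) [B.Normal] :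
    Nat.card (A ⊔ B : Subgroup G) ≤ Nat.card A * Nat.card B := by
  have h : ((A ⊔ B : Subgroup G) : Set G) = (A : Set G) * (B : Set G) :=
    Subgroup.mul_normal A B
  have := Set.natCard_mul_le (s := (A : Set G)) (t := (B : Set G))
  rw [← h] at this
  exact this

lemma natCard_sup_finset_le {G ι : Type*} [Group G] [Finite G] (A : ι → Subgroup G)
    (hA : ∀ i, (A i).Normal) (T : Finset ι) :
    Nat.card (T.sup A : Subgroup G) ≤ ∏ i ∈ T, Nat.card (A i) := by
  classical
  induction T using Finset.induction_on with
  | empty => simp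
  | insert i T hi ih =>
    rw [Finset.sup_insert, Finset.prod_insert hi, sup_comm, mul_comm]
    have := hA i
    exact (natCard_sup_le _ _).trans (Nat.mul_le_mul_right _ ih)

lemma totient_prod_primes {S : Finset ℕ} (hS : ∀ p ∈ S, p.Prime) :
    (∏ p ∈ S, p).totient = ∏ p ∈ S, (p - 1) := by
  induction S using Finset.induction_on with
  | empty => simp
  | insert p S hp ih =>
    have hp' := hS p (Finset.mem_insert_self p S)
    have hS' : ∀ q ∈ S, q.Prime := fun q hq ↦ hS q (Finset.mem_insert_of_mem hq)
    rw [Finset.prod_insert hp, Finset.prod_insert hp, Nat.totient_mul, Nat.totient_prime hp',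
      ih hS']
    refine Nat.Coprime.prod_right fun q hq ↦ (Nat.coprime_primes hp' (hS' q hq)).mpr ?_
    rintro rfl
    exact hp hq

/-- Let `M` be the compositum of a Galois extension `L` of prime degree `ℓ` and the field of
`N`-th roots of unity, where `N = ℓ ^ 3 * ∏ p ∈ S, p` involves all primes ramified in `L`. The
inertia groups generate the abelian group `Gal(M/ℚ)`, and they have at most `φ (ℓ ^ 3)` and
`p - 1` elements, so `[M : ℚ] ≤ φ N`. -/
theorem adjoin_eq_top_of_sup_adjoin_eq_top [IsGalois ℚ M] {ℓ : ℕ} (hℓ : ℓ.Prime)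
    (L : IntermediateField ℚ M) [IsGalois ℚ L] (hL : Module.finrank ℚ L = ℓ) (S : Finset ℕ)
    (hS : ∀ p ∈ S, p.Prime) (hℓS : ℓ ∉ S)
    (hram : ∀ p : ℕ, p.Prime → (p : ℤ) ∣ discr L → p ≠ ℓ → p ∈ S) {ξ : M}
    (hξ : IsPrimitiveRoot ξ (ℓ ^ 3 * ∏ p ∈ S, p)) (hsup : L ⊔ ℚ⟮ξ⟯ = ⊤) : ℚ⟮ξ⟯ = ⊤ := by
  classical
  have : Fact ℓ.Prime := ⟨hℓ⟩
  set N := ℓ ^ 3 * ∏ p ∈ S, p with hN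
  have hS0 : ∏ p ∈ S, p ≠ 0 := Finset.prod_ne_zero_iff.mpr fun p hp ↦ (hS p hp).ne_zero
  have hN0 : N ≠ 0 := mul_ne_zero (pow_ne_zero 3 hℓ.ne_zero) hS0
  have : NeZero N := ⟨hN0⟩
  have hξ0 : ξ ≠ 0 := hξ.ne_zero hN0
  have hdvdS {p : ℕ} (hp : p.Prime) (h : p ∣ ∏ p ∈ S, p) : p ∈ S := by
    obtain ⟨q, hq, hpq⟩ := (Prime.dvd_finsetProd_iff hp.prime _).mp h
    rwa [(Nat.prime_dvd_prime_iff_eq hp (hS q hq)).mp hpq]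
  have hdvdN {p : ℕ} (hp : p.Prime) (h : p ∣ N) : p = ℓ ∨ p ∈ S := by
    rcases (Nat.Prime.dvd_mul hp).mp h with h | h
    · exact Or.inl ((Nat.prime_dvd_prime_iff_eq hp hℓ).mp (hp.dvd_of_dvd_pow h))
    · exact Or.inr (hdvdS hp h)
  -- `Gal(M/ℚ)` is abelian
  have hcommL (f g : Gal(L/ℚ)) : f * g = g * f := by
    have hcard : Nat.card Gal(L/ℚ) = ℓ := by rw [IsGalois.card_aut_eq_finrank, hL]
    have := isCyclic_of_prime_card hcard
    exact (IsCyclic.isMulCommutative (α := Gal(L/ℚ))).is_comm.comm f g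
  have hcomm (σ τ : Gal(M/ℚ)) : σ * τ = τ * σ := by
    refine gal_eq_of_sup_adjoin_eq_top hsup (fun x hx ↦ ?_) ?_
    · have h := hcommL (AlgEquiv.restrictNormalHom L σ) (AlgEquiv.restrictNormalHom L τ)
      rw [← map_mul, ← map_mul] at h
      have h1 := restrictNormal_apply_coe L (σ * τ) ⟨x, hx⟩
      rw [h, restrictNormal_apply_coe] at h1
      exact h1.symm
    · obtain ⟨i, -, hi⟩ := hξ.eq_pow_of_pow_eq_one
        (show σ ξ ^ N = 1 by rw [← map_pow, hξ.pow_eq_one, map_one])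
      obtain ⟨j, -, hj⟩ := hξ.eq_pow_of_pow_eq_one
        (show τ ξ ^ N = 1 by rw [← map_pow, hξ.pow_eq_one, map_one])
      rw [AlgEquiv.mul_apply, AlgEquiv.mul_apply, ← hi, ← hj, map_pow, map_pow, ← hi, ← hj,
        pow_right_comm]
  have hnormal (H : Subgroup Gal(M/ℚ)) : H.Normal :=
    ⟨fun n hn g ↦ by rwa [hcomm g n, mul_inv_cancel_right]⟩
  have hex (p : ℕ) : ∃ P : Ideal (𝓞 M), p.Prime → P.IsPrime ∧ (p : 𝓞 M) ∈ P := by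
    by_cases hp : p.Prime
    · have : Fact p.Prime := ⟨hp⟩
      have := Int.ideal_span_isMaximal_of_prime p
      obtain ⟨P, hP, hPp⟩ := (inferInstance : Nonempty ((Ideal.span {(p : ℤ)}).primesOver (𝓞 M)))
      refine ⟨P, fun _ ↦ ⟨hP, ?_⟩⟩
      have h := (Ideal.liesOver_span_iff Ideal.IsPrime.ne_top'
        (Nat.prime_iff_prime_int.mp hp)).mp hPp
      simpa using h
    · exact ⟨⊥, fun h ↦ absurd h hp⟩
  choose P hP using hex
  let I (p : ℕ) : Subgroup Gal(M/ℚ) := (P p).inertia Gal(M/ℚ)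
  -- an inertia element at `p` fixes the part of `ξ` of order prime to `p`
  have hfix {p a b : ℕ} (hp : p.Prime) (hab : a * b = N) (hpb : ¬ p ∣ b) (h : a.Coprime b)
      {τ : Gal(M/ℚ)} (hτ : τ ∈ I p) (hτL : ∀ x ∈ L, τ x = x) (hτb : τ (ξ ^ b) = ξ ^ b) :
      τ = 1 := by
    have := (hP p hp).1
    have h1 : τ (ξ ^ a) = ξ ^ a := inertia_apply_eq_of_pow_eq_one (m := b) hτ
      (fun hb ↦ hpb ((natCast_mem_iff_dvd hp (hP p hp).2).mp hb))
      (by rw [← pow_mul, hab, hξ.pow_eq_one])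
    exact gal_eq_of_sup_adjoin_eq_top hsup hτL (apply_eq_of_coprime hξ0 h h1 hτb)
  have htop : (insert ℓ S).sup I = ⊤ := by
    have := hnormal ((insert ℓ S).sup I)
    refine eq_top_of_inertia_le _ fun p hp ↦ ⟨P p, (hP p hp).1, (hP p hp).2, ?_⟩
    by_cases hpT : p ∈ insert ℓ S
    · exact Finset.le_sup (f := I) hpT
    · intro τ hτ
      have hp' := (hP p hp).1
      rw [Finset.mem_insert, not_or] at hpT
      have h1 : τ = 1 := by
        refine hfix hp (one_mul N) (fun hd ↦ ?_) (Nat.coprime_one_left N) hτ (fun x hx ↦ ?_) ?_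
        · rcases hdvdN hp hd with h | h
          · exact hpT.1 h
          · exact hpT.2 h
        · exact inertia_apply_eq_of_not_dvd_discr L hp
            (fun hd ↦ hpT.2 (hram p hp hd hpT.1)) (hP p hp).2 hτ hx
        · rw [hξ.pow_eq_one, map_one]
      rw [h1]
      exact one_mem _
  have hwild : Nat.card (I ℓ) ≤ (ℓ ^ 3).totient := by
    set m := ∏ p ∈ S, p with hm
    have hz : IsPrimitiveRoot (ξ ^ m) (ℓ ^ 3) := hξ.pow (Nat.pos_of_ne_zero hN0) (mul_comm _ _)
    have hℓm : ¬ ℓ ∣ m := fun h ↦ hℓS (hdvdS hℓ h)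
    have hcop : (ℓ ^ 3).Coprime m :=
      Nat.Coprime.pow_left 3 ((Nat.Prime.coprime_iff_not_dvd hℓ).mpr hℓm)
    have : NeZero (ℓ ^ 3) := ⟨pow_ne_zero 3 hℓ.ne_zero⟩
    let E : IntermediateField ℚ M := ℚ⟮ξ ^ m⟯
    have : IsCyclotomicExtension {ℓ ^ 3} ℚ E :=
      hz.intermediateField_adjoin_isCyclotomicExtension ℚ
    have : IsGalois ℚ E := IsCyclotomicExtension.isGalois {ℓ ^ 3} ℚ E
    rw [← IsCyclotomicExtension.Rat.finrank (ℓ ^ 3) E, ← IsGalois.card_aut_eq_finrank]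
    refine Nat.card_le_card_of_injective
      ((AlgEquiv.restrictNormalHom E).comp (I ℓ).subtype) ?_
    rw [injective_iff_map_eq_one]
    intro τ hτ
    have := (hP ℓ hℓ).1
    have hτz : τ.1 (ξ ^ m) = ξ ^ m := by
      have h := restrictNormal_apply_coe E τ.1
        ⟨ξ ^ m, IntermediateField.mem_adjoin_simple_self ℚ _⟩
      have hτ' : AlgEquiv.restrictNormalHom E τ.1 = 1 := hτ
      rw [hτ'] at h
      exact h.symm
    exact Subtype.ext (hfix hℓ rfl hℓm hcop τ.2
      (fun x hx ↦ inertia_apply_eq_of_mem hcomm hℓ hz L hL (hP ℓ hℓ).2 τ.2 hτz hx) hτz)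
  have htame (p : ℕ) (hpS : p ∈ S) : Nat.card (I p) ≤ p - 1 := by
    have hp := hS p hpS
    have hpℓ : p ≠ ℓ := fun h ↦ hℓS (h ▸ hpS)
    have := (hP p hp).1
    set b := ℓ ^ 3 * ∏ q ∈ S.erase p, q with hb
    have hpb : p * b = N := by rw [hb, hN, ← Finset.mul_prod_erase S _ hpS]; ring
    have hpb' : ¬ p ∣ b := by
      intro h
      rcases (Nat.Prime.dvd_mul hp).mp h with h | h
      · exact hpℓ ((Nat.prime_dvd_prime_iff_eq hp hℓ).mp (hp.dvd_of_dvd_pow h))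
      · obtain ⟨q, hq, hpq⟩ := (Prime.dvd_finsetProd_iff hp.prime _).mp h
        rw [Finset.mem_erase] at hq
        exact hq.1 ((Nat.prime_dvd_prime_iff_eq hp (hS q hq.2)).mp hpq).symm
    have hz : IsPrimitiveRoot (ξ ^ b) p :=
      hξ.pow (Nat.pos_of_ne_zero hN0) (by rw [← hpb, mul_comm])
    have : NeZero p := ⟨hp.ne_zero⟩
    let E : IntermediateField ℚ M := ℚ⟮ξ ^ b⟯
    have : IsCyclotomicExtension {p} ℚ E := hz.intermediateField_adjoin_isCyclotomicExtension ℚ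
    have : IsGalois ℚ E := IsCyclotomicExtension.isGalois {p} ℚ E
    have hE : Module.finrank ℚ E = p - 1 := by
      rw [IsCyclotomicExtension.Rat.finrank p E, Nat.totient_prime hp]
    -- an inertia element at `p` is determined by its action on `L` and on the `p`-th roots of unity,
    -- so its order divides `ℓ * (p - 1)`
    refine card_inertia_le_sub_one hcomm hp (hP p hp).2 (n := ℓ * (p - 1)) ?_ fun σ hσ ↦ ?_
    · rw [natCast_mem_iff_dvd hp (hP p hp).2, Nat.Prime.dvd_mul hp, not_or]
      refine ⟨fun h ↦ hpℓ ((Nat.prime_dvd_prime_iff_eq hp hℓ).mp h), fun h ↦ ?_⟩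
      have := Nat.le_of_dvd (Nat.sub_pos_of_lt hp.one_lt) h
      have := hp.pos
      omega
    · refine hfix hp hpb hpb' ((Nat.Prime.coprime_iff_not_dvd hp).mpr hpb') (pow_mem hσ _)
        (fun x hx ↦ ?_) ?_
      · exact pow_finrank_apply_eq L σ (by rw [hL]; exact dvd_mul_right _ _) hx
      · exact pow_finrank_apply_eq E σ (by rw [hE]; exact dvd_mul_left _ _)
          (IntermediateField.mem_adjoin_simple_self ℚ _)
  have htot : N.totient = (ℓ ^ 3).totient * ∏ p ∈ S, (p - 1) := by
    rw [hN, Nat.totient_mul, totient_prod_primes hS]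
    exact Nat.Coprime.pow_left 3
      ((Nat.Prime.coprime_iff_not_dvd hℓ).mpr fun h ↦ hℓS (hdvdS hℓ h))
  have hcardM : Module.finrank ℚ M ≤ N.totient := by
    rw [← IsGalois.card_aut_eq_finrank ℚ M, ← Subgroup.card_top (G := Gal(M/ℚ)), ← htop, htot]
    refine (natCard_sup_finset_le I (fun p ↦ hnormal _) _).trans ?_
    rw [Finset.prod_insert hℓS]
    exact Nat.mul_le_mul hwild (Finset.prod_le_prod' htame)
  have : IsCyclotomicExtension {N} ℚ ℚ⟮ξ⟯ := hξ.intermediateField_adjoin_isCyclotomicExtension ℚ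
  have hfin : Module.finrank ℚ ℚ⟮ξ⟯ = N.totient := IsCyclotomicExtension.Rat.finrank N ℚ⟮ξ⟯
  refine IntermediateField.eq_of_le_of_finrank_le le_top ?_
  rw [IntermediateField.finrank_top', hfin]
  exact hcardM

end NumberField

/-! ### The Kronecker–Weber theorem in prime degree -/

section Compositum

variable {K Ω : Type*} [Field K] [Field Ω] [Algebra K Ω]

lemma adjoin_simple_gen_eq_top (z : Ω) : K⟮IntermediateField.AdjoinSimple.gen K z⟯ = ⊤ := by
  apply IntermediateField.lift_injective K⟮z⟯
  rw [IntermediateField.lift_adjoin_simple, IntermediateField.lift_top]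
  rfl

variable (L : IntermediateField K Ω) (z : Ω)

lemma mem_sup_adjoin_simple : z ∈ L ⊔ K⟮z⟯ :=
  (le_sup_right : K⟮z⟯ ≤ L ⊔ K⟮z⟯) (IntermediateField.mem_adjoin_simple_self K z)

lemma restrict_sup_adjoin_eq_top :
    IntermediateField.restrict (le_sup_left : L ≤ L ⊔ K⟮z⟯) ⊔
      K⟮(⟨z, mem_sup_adjoin_simple L z⟩ : (L ⊔ K⟮z⟯ : IntermediateField K Ω))⟯ = ⊤ := by
  apply IntermediateField.lift_injective (L ⊔ K⟮z⟯)
  rw [IntermediateField.lift_sup, IntermediateField.lift_adjoin_simple,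
    IntermediateField.lift_restrict, IntermediateField.lift_top]

lemma le_adjoin_of_adjoin_eq_top
    (h : K⟮(⟨z, mem_sup_adjoin_simple L z⟩ : (L ⊔ K⟮z⟯ : IntermediateField K Ω))⟯ = ⊤) :
    L ≤ K⟮z⟯ := by
  have h1 := congrArg IntermediateField.lift h
  rw [IntermediateField.lift_adjoin_simple, IntermediateField.lift_top] at h1
  rw [h1]
  exact le_sup_left

lemma inf_eq_bot_of_isPerfect (F C : IntermediateField K Ω) [FiniteDimensional K F]
    [IsGalois K F] [IsAbelianGalois K C] (h : Group.IsPerfect Gal(F/K)) : F ⊓ C = ⊥ := by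
  let E : IntermediateField K F := IntermediateField.restrict (inf_le_left : F ⊓ C ≤ F)
  let e : (F ⊓ C : IntermediateField K Ω) ≃ₐ[K] E := IntermediateField.restrictAlgEquiv _
  have hab : IsAbelianGalois K E := IsAbelianGalois.of_algHom
    ((IntermediateField.inclusion (inf_le_right : F ⊓ C ≤ C)).comp e.symm.toAlgHom)
  have hperf : Group.IsPerfect Gal(E/K) :=
    Group.IsPerfect.ofSurjective (AlgEquiv.restrictNormalHom_surjective (F := K) (K₁ := E) F)
  have hsub : Subsingleton Gal(E/K) := Group.IsPerfect.subsingleton_of_isMulCommutative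
  have hcard : Module.finrank K E = 1 := by
    rw [← IsGalois.card_aut_eq_finrank]
    exact Nat.card_unique
  rw [← IntermediateField.finrank_eq_one_iff, e.toLinearEquiv.finrank_eq, hcard]

end Compositum

lemma finiteDimensional_adjoin_of_isPrimitiveRoot {Ω : Type*} [Field Ω] [CharZero Ω] {z : Ω}
    {n : ℕ} (hn : 0 < n) (hz : IsPrimitiveRoot z n) : FiniteDimensional ℚ ℚ⟮z⟯ :=
  IntermediateField.adjoin.finiteDimensional
    ((hz.isIntegral hn).tower_top (A := ℚ))

lemma isCyclotomicExtension_adjoin_of_isPrimitiveRoot {Ω : Type*} [Field Ω] [CharZero Ω] {z : Ω}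
    {n : ℕ} (hn : 0 < n) (hz : IsPrimitiveRoot z n) : IsCyclotomicExtension {n} ℚ ℚ⟮z⟯ := by
  have : NeZero n := ⟨hn.ne'⟩
  have := finiteDimensional_adjoin_of_isPrimitiveRoot hn hz
  have hgen : IsPrimitiveRoot (IntermediateField.AdjoinSimple.gen ℚ z) n :=
    IsPrimitiveRoot.of_map_of_injective (f := algebraMap ℚ⟮z⟯ Ω) (by simpa using hz)
      (algebraMap ℚ⟮z⟯ Ω).injective
  have htop : ℚ⟮IntermediateField.AdjoinSimple.gen ℚ z⟯ = ⊤ :=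
    adjoin_simple_gen_eq_top z
  have h := hgen.intermediateField_adjoin_isCyclotomicExtension ℚ
  rw [htop] at h
  exact IsCyclotomicExtension.equiv {n} ℚ _ IntermediateField.topEquiv

/-- The Kronecker–Weber theorem for extensions of prime degree: `adjoin_eq_top_of_sup_adjoin_eq_top`
applied to the compositum `L(ζ N)`, where `N` is the product of `ℓ ^ 3` and the primes other than `ℓ`
that divide the discriminant of `L`. -/
theorem exists_le_adjoin_of_finrank_eq_prime {Ω : Type*} [Field Ω] [CharZero Ω]
    (ζ : ℕ → Ω) (hζ : ∀ q : ℕ, 1 ≤ q → IsPrimitiveRoot (ζ q) q) (L : IntermediateField ℚ Ω)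
    [NumberField L] [IsGalois ℚ L] {ℓ : ℕ} (hℓ : ℓ.Prime) (hL : Module.finrank ℚ L = ℓ) :
    ∃ N : ℕ, 1 ≤ N ∧ L ≤ ℚ⟮ζ N⟯ := by
  classical
  set S := (discr L).natAbs.primeFactors.erase ℓ with hS
  have hSp : ∀ p ∈ S, p.Prime := fun p hp ↦
    Nat.prime_of_mem_primeFactors (Finset.mem_of_mem_erase hp)
  set N := ℓ ^ 3 * ∏ p ∈ S, p with hN
  have hN1 : 1 ≤ N := Nat.one_le_iff_ne_zero.mpr (mul_ne_zero (pow_ne_zero 3 hℓ.ne_zero)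
    (Finset.prod_ne_zero_iff.mpr fun p hp ↦ (hSp p hp).ne_zero))
  have hz := hζ N hN1
  refine ⟨N, hN1, ?_⟩
  have : FiniteDimensional ℚ ℚ⟮ζ N⟯ := finiteDimensional_adjoin_of_isPrimitiveRoot hN1 hz
  have := isCyclotomicExtension_adjoin_of_isPrimitiveRoot hN1 hz
  have : IsGalois ℚ ℚ⟮ζ N⟯ := IsCyclotomicExtension.isGalois {N} ℚ ℚ⟮ζ N⟯
  let M : IntermediateField ℚ Ω := L ⊔ ℚ⟮ζ N⟯
  have : FiniteDimensional ℚ M := IntermediateField.finiteDimensional_sup L ℚ⟮ζ N⟯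
  have : NumberField M := {}
  have hLn : Normal ℚ L := IsGalois.to_normal
  have hCn : Normal ℚ ℚ⟮ζ N⟯ := IsGalois.to_normal
  -- the `Normal` instances are passed by hand: those found by inference over the field `ℚ` carry
  -- the `ℚ`-algebra structure of a field of characteristic zero, not that of an intermediate field
  have : Normal ℚ M := @IntermediateField.normal_sup ℚ Ω _ _ _ L ℚ⟮ζ N⟯ hLn hCn
  have : IsGalois ℚ M := {}
  let L' : IntermediateField ℚ M := IntermediateField.restrict (le_sup_left : L ≤ M)
  let e : L ≃ₐ[ℚ] L' := IntermediateField.restrictAlgEquiv _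
  have : IsGalois ℚ L' := IsGalois.of_algEquiv e
  let ξ : M := ⟨ζ N, mem_sup_adjoin_simple L (ζ N)⟩
  have hξ : IsPrimitiveRoot ξ N :=
    IsPrimitiveRoot.of_map_of_injective (f := algebraMap M Ω) hz (algebraMap M Ω).injective
  have hsup : L' ⊔ ℚ⟮ξ⟯ = ⊤ := restrict_sup_adjoin_eq_top L (ζ N)
  have htop := adjoin_eq_top_of_sup_adjoin_eq_top hℓ L' (by rw [← e.toLinearEquiv.finrank_eq, hL])
    S hSp (Finset.notMem_erase ℓ _) (fun p hp hd hpℓ ↦ by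
      rw [← discr_eq_discr_of_algEquiv _ e] at hd
      rw [hS, Finset.mem_erase, Nat.mem_primeFactors]
      exact ⟨hpℓ, hp, Int.natCast_dvd.mp hd, by simpa using discr_ne_zero L⟩) hξ hsup
  exact le_adjoin_of_adjoin_eq_top L (ζ N) htop

/-! ### Perfect Galois groups and cyclotomic fields -/

/-- A finite group that is not perfect has a normal subgroup of prime index: any maximal subgroup
containing the commutator subgroup. -/
lemma exists_normal_index_prime_of_not_isPerfect {G : Type*} [Group G] [Finite G]
    (h : ¬ Group.IsPerfect G) : ∃ H : Subgroup G, H.Normal ∧ H.index.Prime := by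
  rw [Group.isPerfect_def] at h
  obtain ⟨H, hH, hle⟩ := (eq_top_or_exists_le_coatom (commutator G)).resolve_left h
  have hnorm : H.Normal := Subgroup.Normal.of_commutator_le G hle
  refine ⟨H, hnorm, ?_⟩
  have : IsMulCommutative (G ⧸ H) := Subgroup.Normal.quotient_commutative_iff_commutator_le.mpr hle
  have hnt : Nontrivial (G ⧸ H) := by
    rw [QuotientGroup.nontrivial_iff]
    exact hH.1
  have hsimple : IsSimpleGroup (G ⧸ H) := by
    refine ⟨fun K _ ↦ ?_⟩
    have hHK : H ≤ K.comap (QuotientGroup.mk' H) := by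
      conv_lhs => rw [← QuotientGroup.ker_mk' H]
      exact Subgroup.ker_le_comap _ _
    rcases hH.le_iff.mp hHK with h1 | h1
    · right
      rw [← Subgroup.map_comap_eq_self_of_surjective (QuotientGroup.mk'_surjective H) K, h1,
        Subgroup.map_top_of_surjective _ (QuotientGroup.mk'_surjective H)]
    · left
      rw [← Subgroup.map_comap_eq_self_of_surjective (QuotientGroup.mk'_surjective H) K, h1,
        QuotientGroup.map_mk'_self]
  exact Group.is_simple_iff_prime_card.mp hsimple

/-- `F` is a Galois number field inside an algebraically closed field `Ω` of characteristic zero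
(for instance `ℂ` or an algebraic closure of `ℚ`), and `ζ q` is a primitive `q`-th root of unity
in `Ω` for each `q ≥ 1`. -/
theorem mainTheorem6 {Ω : Type*} [Field Ω] [CharZero Ω] [IsAlgClosed Ω]
    (ζ : ℕ → Ω) (hζ : ∀ q : ℕ, 1 ≤ q → IsPrimitiveRoot (ζ q) q)
    (F : IntermediateField ℚ Ω) [NumberField F] [IsGalois ℚ F] :
    (IsTotallyNonAbelian F ↔ ∀ q : ℕ, 1 ≤ q → F.LinearDisjoint ℚ⟮ζ q⟯) ∧
      (IsTotallyNonAbelian F ↔ ∀ q : ℕ, 1 ≤ q → F ⊓ ℚ⟮ζ q⟯ = ⊥) := by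
  have hdisj : (∀ q : ℕ, 1 ≤ q → F.LinearDisjoint ℚ⟮ζ q⟯) ↔
      ∀ q : ℕ, 1 ≤ q → F ⊓ ℚ⟮ζ q⟯ = ⊥ := by
    refine forall₂_congr fun q hq ↦ ?_
    have := finiteDimensional_adjoin_of_isPrimitiveRoot hq (hζ q hq)
    exact @IntermediateField.LinearDisjoint.iff_inf_eq_bot ℚ Ω _ _ _ F ℚ⟮ζ q⟯ ‹_› _ ‹_›
  rw [hdisj, and_self]
  constructor
  · rintro ⟨-, hperf⟩ q hq
    have := isCyclotomicExtension_adjoin_of_isPrimitiveRoot hq (hζ q hq)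
    have : IsAbelianGalois ℚ ℚ⟮ζ q⟯ := IsCyclotomicExtension.isAbelianGalois {q} ℚ ℚ⟮ζ q⟯
    exact @inf_eq_bot_of_isPerfect ℚ Ω _ _ _ F ℚ⟮ζ q⟯ _ ‹_› ‹_› hperf
  · refine fun h ↦ ⟨inferInstance, ?_⟩
    by_contra hperf
    obtain ⟨H, hH, hprime⟩ := exists_normal_index_prime_of_not_isPerfect hperf
    let K : IntermediateField ℚ F := IntermediateField.fixedField H
    have : IsGalois ℚ K := IsGalois.of_fixedField_normal_subgroup H
    have hK : Module.finrank ℚ K = H.index := by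
      rw [IntermediateField.finrank_eq_fixingSubgroup_index,
        IntermediateField.fixingSubgroup_fixedField]
    -- `K` has prime degree over `ℚ`; seen inside `Ω` it lies in a cyclotomic field, hence in `ℚ`
    let L : IntermediateField ℚ Ω := IntermediateField.lift K
    let e : K ≃ₐ[ℚ] L := IntermediateField.liftAlgEquiv K
    have : NumberField L := NumberField.of_ringEquiv K L e.toRingEquiv
    have : IsGalois ℚ L := IsGalois.of_algEquiv e
    have hL : Module.finrank ℚ L = H.index := by rw [← e.toLinearEquiv.finrank_eq, hK]
    obtain ⟨N, hN, hle⟩ := exists_le_adjoin_of_finrank_eq_prime ζ hζ L hprime hL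
    have hbot : L = ⊥ := by
      rw [← le_bot_iff, ← h N hN]
      exact le_inf (IntermediateField.lift_le K) hle
    rw [hbot, IntermediateField.finrank_bot] at hL
    exact hprime.ne_one hL.symm
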